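/- Let $n\ge 1$, let $\sigma:\mathbb{R}^d\to\mathbb{R}^{d\times d}$ and $b:\mathbb{R}^d\to\mathbb{R}^d$ be Lipschitz continuous, and let $(\Omega,\mathcal F,\mathbb P)$ be a probability space carrying $n$ independent copies $X^1,\dots,X^n$ of the nonlinear diffusion process $$X^i_t=X^i_0+\int_0^t\!\int_{\mathbb{R}^d}\sigma(X^i_s-y)\,W^i_P(dy,ds)+\int_0^t\!\int_{\mathbb{R}^d}b(X^i_s-y)\,P_s(dy)\,ds,\qquad t\ge 0,$$ where $P_t$ is the law of $X^i_t$ (the same for all $i$), $W^1_P,\dots,W^n_P$ are independent $\mathbb{R}^d$-valued space-time white noises on $[0,\infty)\times\mathbb{R}^d$ whose $d$ coordinates are independent and each have covariance measure $P_t(dy)\,dt$, the initial conditions $X^1_0,\dots,X^n_0$ are independent with law $P_0$ and independent of the white noises, and the stochastic integrals are in the sense of Walsh. Let $(\mathcal F^n_t)_{t\ge0}$ be the complete right-continuous filtration generated by the variables $W^i_P([0,s]\times A)$, $0\le s\le t$, $A\subset\mathbb{R}^d$ Borel, $1\le i\le n$, and by $X^1_0,\dots,X^n_0$; the processes $X^i$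 are continuous and $(\mathcal F^n_t)$-adapted. Assume that $\int|x|^2P_0(dx)<\infty$ and that $P_t$ has a density with respect to Lebesgue measure for every $t>0$. Let $\nu^n_t(\omega)=\frac1n\sum_{i=1}^n\delta_{X^i_t(\omega)}$. Then there is a function $T^n:[0,\infty)\times\Omega\times\mathbb{R}^d\to\mathbb{R}^d$, measurable with respect to the product of the predictable $\sigma$-field of $(\mathcal F^n_t)$ on $[0,\infty)\times\Omega$ and the Borel $\sigma$-field of $\mathbb{R}^d$, such that for $dt\otimes\mathbb P$-almost every $(t,\omega)$ the Brenier map $T^{t,\omega,n}$ from $P_t$ to $\nu^n_t(\omega)$ exists and $$T^n(t,\omega,x)=T^{t,\omega,n}(x)\qquad\text{for }P_t(dx)\text{-almost every }x.$$ Here the Brenier map from $\mu$ to $\nu$ is the ($\mu$-a.e. unique) measurable map $S$ such that $\mu(dx)\,\delta_{S(x)}(dy)$ is the unique minimizer of $\int|x-y|^2\,\pi(dx,dy)$ among the probability measures $\pi$ on $\mathbb{R}^{2d}$ with marginals $\mu$ and $\nu$. -/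

import Mathlib

open MeasureTheory ProbabilityTheory Filter Topology
open scoped NNReal ENNReal

noncomputable section

namespace NonlinearDiffusion

/-- The Euclidean space `ℝ^d`. -/
abbrev E (d : ℕ) : Type := EuclideanSpace ℝ (Fin d)

/-! ### Optimal transport with quadratic cost -/

/-- The quadratic transport cost `∫ |x - y|² π(dx, dy)`. -/
def cost {d : ℕ} (π : Measure (E d × E d)) : ℝ≥0∞ :=
  ∫⁻ q, ‖q.1 - q.2‖ₑ ^ 2 ∂π

/-- `π` is a transfer plan between `μ` and `ν`: its marginals are `μ` and `ν`. -/
def IsPlan {d : ℕ} (μ ν : Measure (E d)) (π : Measure (E d × E d)) : Prop :=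
  π.map Prod.fst = μ ∧ π.map Prod.snd = ν

/-- `π` is a minimizer of the Monge-Kantorovich problem with quadratic cost. -/
def IsOptimalPlan {d : ℕ} (μ ν : Measure (E d)) (π : Measure (E d × E d)) : Prop :=
  IsPlan μ ν π ∧ ∀ π', IsPlan μ ν π' → cost π ≤ cost π'

/-- `S` is the Brenier map (optimal transport map) from `μ` to `ν`: it is measurable, and
`μ(dx) δ_{S(x)}(dy)` is the unique optimal transfer plan between `μ` and `ν`. -/
def IsBrenierMap {d : ℕ} (μ ν : Measure (E d)) (S : E d → E d) : Prop :=
  Measurable S ∧ IsOptimalPlan μ ν (μ.map fun x => (x, S x)) ∧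
    ∀ π, IsOptimalPlan μ ν π → π = μ.map fun x => (x, S x)

/-- The empirical measure `n⁻¹ ∑ i, δ_{x i}`. -/
def empirical {d n : ℕ} (x : Fin n → E d) : Measure (E d) :=
  (n : ℝ≥0∞)⁻¹ • ∑ i, Measure.dirac (x i)

/-! ### Space-time white noise -/

/-- Lebesgue measure `dt` on the time axis `[0, ∞)`. -/
def timeMeasure : Measure ℝ≥0 :=
  (volume.restrict (Set.Ici (0 : ℝ))).map Real.toNNReal

instance : SFinite timeMeasure := by unfold timeMeasure; infer_instance

/-- The covariance measure `P_t(dy) dt` on `[0, ∞) × ℝ^d`. -/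
def covMeasure {d : ℕ} (P : Kernel ℝ≥0 (E d)) : Measure (ℝ≥0 × E d) :=
  timeMeasure ⊗ₘ P

lemma timeMeasure_Iic (s : ℝ≥0) : timeMeasure (Set.Iic s) = s := by
  unfold timeMeasure
  rw [Measure.map_apply measurable_real_toNNReal measurableSet_Iic,
    Measure.restrict_apply (measurable_real_toNNReal measurableSet_Iic)]
  have h : Real.toNNReal ⁻¹' Set.Iic s ∩ Set.Ici (0 : ℝ) = Set.Icc 0 (s : ℝ) := by
    ext x
    simp only [Set.mem_inter_iff, Set.mem_preimage, Set.mem_Iic, Set.mem_Ici, Set.mem_Icc,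
      Real.toNNReal_le_iff_le_coe]
    exact and_comm
  rw [h]
  simp

lemma covMeasure_rect_lt_top {d : ℕ} (P : Kernel ℝ≥0 (E d)) [IsMarkovKernel P]
    (s : ℝ≥0) {A : Set (E d)} (hA : MeasurableSet A) :
    covMeasure P (Set.Iic s ×ˢ A) < ∞ := by
  unfold covMeasure
  rw [Measure.compProd_apply_prod measurableSet_Iic hA]
  calc ∫⁻ a in Set.Iic s, P a A ∂timeMeasure
      ≤ ∫⁻ _ in Set.Iic s, 1 ∂timeMeasure := lintegral_mono fun _ => prob_le_one
    _ = s := by simp [timeMeasure_Iic]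
    _ < ∞ := ENNReal.coe_lt_top

/-- `W` is an `ℝ^d`-valued space-time white noise on `[0, ∞) × ℝ^d` with independent coordinates,
each of covariance measure `m`: the variables `W^k(A)`, for `A` a Borel set with `m A < ∞` and
`k = 1, …, d`, form a centered Gaussian process, and `E[W^k(A) W^l(B)] = δ_{kl} m(A ∩ B)`. -/
structure IsWhiteNoise {d : ℕ} {Ω : Type*} [MeasurableSpace Ω] (μ : Measure Ω)
    (m : Measure (ℝ≥0 × E d)) (W : Set (ℝ≥0 × E d) → Ω → E d) : Prop where
  measurable : ∀ A, MeasurableSet A → m A < ∞ → Measurable (W A)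
  gaussian : IsGaussianProcess
    (fun (q : {A : Set (ℝ≥0 × E d) // MeasurableSet A ∧ m A < ∞} × Fin d) (ω : Ω) =>
      W q.1.1 ω q.2) μ
  centered : ∀ A, MeasurableSet A → m A < ∞ → ∀ k, ∫ ω, W A ω k ∂μ = 0
  covariance : ∀ A B, MeasurableSet A → m A < ∞ → MeasurableSet B → m B < ∞ → ∀ k l,
    ∫ ω, W A ω k * W B ω l ∂μ = if k = l then (m (A ∩ B)).toReal else 0

/-- The `σ`-field generated by all the variables `W(A)`, `A` Borel with `m A < ∞`. -/
@[reducible]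
def noiseSigma {d : ℕ} {Ω : Type*} (m : Measure (ℝ≥0 × E d))
    (W : Set (ℝ≥0 × E d) → Ω → E d) : MeasurableSpace Ω :=
  ⨆ (A : Set (ℝ≥0 × E d)) (_ : MeasurableSet A ∧ m A < ∞),
    MeasurableSpace.comap (W A) inferInstance

/-! ### The filtration of the white noises and the initial conditions -/

/-- The `σ`-field generated by the variables `W^i([0, s] × A)`, `s ≤ t`, `A` Borel, by the
initial conditions `ξ^i`, and by the null events. -/
@[reducible]
def rawSigma {d n : ℕ} {Ω : Type*} [MeasurableSpace Ω] (μ : Measure Ω)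
    (W : Fin n → Set (ℝ≥0 × E d) → Ω → E d) (ξ : Fin n → Ω → E d) (t : ℝ≥0) :
    MeasurableSpace Ω :=
  (⨆ (i : Fin n) (s : ℝ≥0) (_ : s ≤ t) (A : Set (E d)) (_ : MeasurableSet A),
      MeasurableSpace.comap (W i (Set.Iic s ×ˢ A)) inferInstance) ⊔
    (⨆ i : Fin n, MeasurableSpace.comap (ξ i) inferInstance) ⊔
    MeasurableSpace.generateFrom {N : Set Ω | MeasurableSet N ∧ μ N = 0}

/-- The complete right-continuous filtration generated by the white noises `W^1, …, W^n` and the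
initial conditions `ξ^1, …, ξ^n`. -/
def noiseFiltration {d n : ℕ} {Ω : Type*} [mΩ : MeasurableSpace Ω] (μ : Measure Ω)
    (P : Kernel ℝ≥0 (E d)) [IsMarkovKernel P]
    (W : Fin n → Set (ℝ≥0 × E d) → Ω → E d) (hW : ∀ i, IsWhiteNoise μ (covMeasure P) (W i))
    (ξ : Fin n → Ω → E d) (hξ : ∀ i, Measurable (ξ i)) : Filtration ℝ≥0 mΩ :=
  Filtration.rightCont
    { seq := rawSigma μ W ξ
      mono' := by
        intro s t hst
        refine sup_le_sup_right (sup_le_sup_right ?_ _) _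
        refine iSup_mono fun i => iSup_mono fun r => ?_
        exact iSup_le fun hr => le_iSup_of_le (hr.trans hst) le_rfl
      le' := by
        intro t
        refine sup_le (sup_le ?_ ?_) ?_
        · refine iSup_le fun i => iSup_le fun s => iSup_le fun _ => iSup_le fun A =>
            iSup_le fun hA => ?_
          exact ((hW i).measurable _ (measurableSet_Iic.prod hA)
            (covMeasure_rect_lt_top P s hA)).comap_le
        · exact iSup_le fun i => (hξ i).comap_le
        · exact MeasurableSpace.generateFrom_le fun N hN => hN.1 }

/-! ### Stochastic integration with respect to a white noise -/

/-- A simple predictable integrand `∑ j, ξ_j(ω) 1_{(a_j, b_j]}(s) 1_{A_j}(y)`, where `ξ_j` is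
bounded and `𝓕_{a_j}`-measurable. -/
structure SimpleIntegrand (d : ℕ) {Ω : Type*} [mΩ : MeasurableSpace Ω]
    (𝓕 : Filtration ℝ≥0 mΩ) where
  card : ℕ
  a : Fin card → ℝ≥0
  b : Fin card → ℝ≥0
  le : ∀ j, a j ≤ b j
  A : Fin card → Set (E d)
  measurableSet : ∀ j, MeasurableSet (A j)
  ξ : Fin card → Ω → ℝ
  measurable : ∀ j, Measurable[𝓕 (a j)] (ξ j)
  bounded : ∀ j, ∃ C, ∀ ω, |ξ j ω| ≤ C

/-- The random field of a simple integrand. -/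
def SimpleIntegrand.eval {d : ℕ} {Ω : Type*} [mΩ : MeasurableSpace Ω] {𝓕 : Filtration ℝ≥0 mΩ}
    (φ : SimpleIntegrand d 𝓕) (s : ℝ≥0) (ω : Ω) (y : E d) : ℝ :=
  ∑ j, (Set.Ioc (φ.a j) (φ.b j) ×ˢ φ.A j).indicator (fun _ => φ.ξ j ω) (s, y)

/-- The stochastic integral `∑ j, ξ_j (W_{t ∧ b_j}(A_j) - W_{t ∧ a_j}(A_j))` of a simple integrand
over `[0, t] × ℝ^d`, where `W_s(A) = W([0, s] × A)`. -/
def SimpleIntegrand.integral {d : ℕ} {Ω : Type*} [mΩ : MeasurableSpace Ω]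
    {𝓕 : Filtration ℝ≥0 mΩ} (φ : SimpleIntegrand d 𝓕) (W : Set (ℝ≥0 × E d) → Ω → ℝ) (t : ℝ≥0)
    (ω : Ω) : ℝ :=
  ∑ j, φ.ξ j ω * (W (Set.Iic (min t (φ.b j)) ×ˢ φ.A j) ω - W (Set.Iic (min t (φ.a j)) ×ˢ φ.A j) ω)

/-- `I` is the stochastic integral (in the sense of Walsh) of the random field `f` over
`[0, t] × ℝ^d` with respect to the real white noise `W` of covariance measure `m`: there are simple
integrands converging to `f` in `L²(P(dω) ⊗ 1_{s ≤ t} m(ds, dy))` whose integrals converge to `I`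
in `L²(P)`. -/
def IsWalshIntegral {d : ℕ} {Ω : Type*} [mΩ : MeasurableSpace Ω] (μ : Measure Ω)
    (𝓕 : Filtration ℝ≥0 mΩ) (m : Measure (ℝ≥0 × E d)) (W : Set (ℝ≥0 × E d) → Ω → ℝ)
    (f : ℝ≥0 → Ω → E d → ℝ) (t : ℝ≥0) (I : Ω → ℝ) : Prop :=
  AEMeasurable I μ ∧ ∃ φ : ℕ → SimpleIntegrand d 𝓕,
    Tendsto (fun r => ∫⁻ ω, ∫⁻ q in Set.Iic t ×ˢ Set.univ,
      ‖(φ r).eval q.1 ω q.2 - f q.1 ω q.2‖ₑ ^ 2 ∂m ∂μ) atTop (𝓝 0) ∧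
    Tendsto (fun r => ∫⁻ ω, ‖(φ r).integral W t ω - I ω‖ₑ ^ 2 ∂μ) atTop (𝓝 0)

/-! ### The nonlinear process -/

/-- `X` is a nonlinear diffusion process with coefficients `σ`, `b`, driven by the white noise `W`,
with respect to the filtration `𝓕`: it is continuous and adapted, `P_t` is the law of `X_t`, and
`X_t = X_0 + ∫_0^t ∫ σ(X_s - y) W(dy, ds) + ∫_0^t ∫ b(X_s - y) P_s(dy) ds`,
all the integrals being well defined. The `j`-th coordinate of the stochastic integral
is `∑ k, ∫_0^t ∫ σ_{jk}(X_s - y) W^k(dy, ds)`. -/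
structure IsNonlinearProcess {d : ℕ} {Ω : Type*} [mΩ : MeasurableSpace Ω] (μ : Measure Ω)
    (𝓕 : Filtration ℝ≥0 mΩ) (σ : E d → Matrix (Fin d) (Fin d) ℝ) (b : E d → E d)
    (P : Kernel ℝ≥0 (E d)) (W : Set (ℝ≥0 × E d) → Ω → E d) (X : ℝ≥0 → Ω → E d) : Prop where
  continuous : ∀ ω, Continuous fun t => X t ω
  adapted : ∀ t, Measurable[𝓕 t] (X t)
  law : ∀ t, μ.map (X t) = P t
  drift_integrable : ∀ t, ∀ᵐ ω ∂μ,
    IntegrableOn (fun q : ℝ≥0 × E d => b (X q.1 ω - q.2)) (Set.Iic t ×ˢ Set.univ) (covMeasure P)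
  equation : ∀ t, ∃ I : Fin d → Fin d → Ω → ℝ,
    (∀ j k, IsWalshIntegral μ 𝓕 (covMeasure P) (fun A ω => W A ω k)
      (fun s ω y => σ (X s ω - y) j k) t (I j k)) ∧
    ∀ᵐ ω ∂μ, ∀ j, X t ω j = X 0 ω j + ∑ k, I j k ω +
      (∫ s in Set.Iic t, ∫ y, b (X s ω - y) ∂(P s) ∂timeMeasure) j

end NonlinearDiffusion

end

/-!
The Brenier maps are chosen as a Borel function of the time, of the positions of the particles and
of the space variable, into which the processes are then substituted.

**The semi-discrete Brenier map.** Let `μ` be an absolutely continuous probability measure with a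
finite second moment, and let `x i`, `i < n`, be the target points. The Kantorovich dual functional
`w ↦ ∫ min_i (|y - x_i|² - w_i) μ(dy) + n⁻¹ ∑ w_i` is concave and attains its maximum
(`exists_forall_dualFun_le`). At a maximum `w`, the first order condition bounds from below the mass
of the region where the minimum is attained in a given set of indices
(`card_div_le_measure_cells`). Two different target points are tied only on a hyperplane, a
`μ`-null set, so the map `targetMap x w` sending `y` to the target point of smallest shifted cost
transports `μ` to the empirical measure. Complementary slackness shows that a plan is optimal only
if it is carried by the graph of this map (`isBrenierMap_targetMap`). This covers coinciding target
points as well: the prices at a maximum are then equal.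

**Measurability.** The dual functional is measurable in the parameters `(t, x)` and concave in `w`.
The maximizer of smallest norm is the limit of approximate maximizers of the functional penalized by
a small multiple of `|w|²`, taken in a countable dense set, hence it is measurable in the parameters
(`exists_measurable_maximizer`). With a kernel `P_t` in place of `μ` this yields a Borel map
`G((t, x), y)` (`exists_measurable_brenierMap`). Since continuous adapted processes are predictable,
`T(t, ω, y) = G((t, X_t(ω)), y)` has the required measurability.

**Second moments.** It remains to see that `P_t` has a finite second moment for almost every `t`;
here the equation is used. The increments of a noise after time `u` are independent of the noises up
to time `u` and of the initial conditions, because the noise is Gaussian with uncorrelated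
increments; right continuity of the filtration is dealt with by letting `u` decrease to the starting
time. This gives the isometry for simple integrands, so that a Walsh integral is square integrable,
with a bound that is uniform over bounded times. The drift is bounded pathwise by
`C + K ∫_0^t |X_s| ds`: Lipschitz continuity allows a comparison with the drift along one fixed path
on which it is integrable. As the paths are continuous, a Gronwall argument applies to each of them,
and integrating over `ω` afterwards gives `E |X_t|² < ∞` for almost every `t`
(`ae_lintegral_sq_lt_top`).
-/

set_option linter.unusedSectionVars false

noncomputable section

namespace NonlinearDiffusion

/-! ### The dual of the semi-discrete transport problem -/

section SemiDiscrete

variable {d n : ℕ}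

/-- The cost of sending `y` to the `i`-th target point `x i`, minus the price `w i`. -/
def shiftedCost (x : Fin n → E d) (w : E n) (y : E d) (i : Fin n) : ℝ := ‖y - x i‖ ^ 2 - w i

/-- The lower envelope `y ↦ min_i (|y - x_i|² - w_i)` of the shifted costs. -/
def lowerEnv (x : Fin n → E d) (w : E n) (y : E d) : ℝ := ⨅ i, shiftedCost x w y i

/-- The Kantorovich dual functional of the transport problem from `μ` to `empirical x`, as a
function of the prices `w`. -/
def dualFun (μ : Measure (E d)) (x : Fin n → E d) (w : E n) : ℝ :=
  ∫ y, lowerEnv x w y ∂μ + (n : ℝ)⁻¹ * ∑ i, w i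

lemma lowerEnv_le (x : Fin n → E d) (w : E n) (y : E d) (i : Fin n) :
    lowerEnv x w y ≤ shiftedCost x w y i :=
  ciInf_le (Set.finite_range _).bddBelow i

lemma exists_shiftedCost_eq_lowerEnv [NeZero n] (x : Fin n → E d) (w : E n) (y : E d) :
    ∃ i, shiftedCost x w y i = lowerEnv x w y :=
  exists_eq_ciInf_of_finite

lemma le_lowerEnv [NeZero n] {x : Fin n → E d} {w : E n} {y : E d} {c : ℝ}
    (h : ∀ i, c ≤ shiftedCost x w y i) : c ≤ lowerEnv x w y :=
  le_ciInf h

lemma measurable_shiftedCost (i : Fin n) :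
    Measurable fun q : ((Fin n → E d) × E n) × E d => shiftedCost q.1.1 q.1.2 q.2 i := by
  unfold shiftedCost
  fun_prop

lemma measurable_lowerEnv :
    Measurable fun q : ((Fin n → E d) × E n) × E d => lowerEnv q.1.1 q.1.2 q.2 :=
  Measurable.iInf fun i => measurable_shiftedCost i

lemma measurable_lowerEnv_right (x : Fin n → E d) (w : E n) : Measurable (lowerEnv x w) := by
  unfold lowerEnv shiftedCost
  fun_prop

lemma abs_coord_le (w : E n) (i : Fin n) : |w i| ≤ ‖w‖ := by
  simpa using PiLp.norm_apply_le w i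

lemma lowerEnv_sub_le [NeZero n] (x : Fin n → E d) (w w' : E n) (y : E d) :
    lowerEnv x w y - ‖w - w'‖ ≤ lowerEnv x w' y := by
  refine le_lowerEnv fun i => ?_
  have h1 := lowerEnv_le x w y i
  have h2 := (abs_le.1 (abs_coord_le (w - w') i)).1
  simp only [shiftedCost, PiLp.sub_apply] at *
  linarith

lemma integrable_norm_sq {μ : Measure (E d)} (hμ : ∫⁻ y, ‖y‖ₑ ^ 2 ∂μ < ∞) :
    Integrable (fun y => ‖y‖ ^ 2) μ := by
  refine ⟨by fun_prop, ?_⟩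
  rw [hasFiniteIntegral_iff_enorm]
  refine lt_of_eq_of_lt (lintegral_congr fun y => ?_) hμ
  rw [enorm_pow, enorm_norm]

lemma norm_sub_sq_le (y z : E d) : ‖y - z‖ ^ 2 ≤ 2 * ‖y‖ ^ 2 + 2 * ‖z‖ ^ 2 := by
  have h := norm_sub_le y z
  nlinarith [sq_nonneg (‖y‖ - ‖z‖), norm_nonneg (y - z), norm_nonneg y, norm_nonneg z]

lemma abs_lowerEnv_le [NeZero n] (x : Fin n → E d) (w : E n) (y : E d) :
    |lowerEnv x w y| ≤ 2 * ‖y‖ ^ 2 + (∑ i, 2 * ‖x i‖ ^ 2 + ‖w‖) := by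
  obtain ⟨i, hi⟩ := exists_shiftedCost_eq_lowerEnv x w y
  rw [← hi, shiftedCost]
  have h1 := norm_sub_sq_le y (x i)
  have h2 : 2 * ‖x i‖ ^ 2 ≤ ∑ i, 2 * ‖x i‖ ^ 2 :=
    Finset.single_le_sum (f := fun i => 2 * ‖x i‖ ^ 2) (fun _ _ => by positivity)
      (Finset.mem_univ i)
  have h3 := abs_le.1 (abs_coord_le w i)
  rw [abs_le]
  constructor <;> nlinarith [sq_nonneg ‖y - x i‖, sq_nonneg ‖y‖, sq_nonneg ‖x i‖]

lemma integrable_lowerEnv [NeZero n] {μ : Measure (E d)} [IsFiniteMeasure μ]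
    (hμ : ∫⁻ y, ‖y‖ₑ ^ 2 ∂μ < ∞) (x : Fin n → E d) (w : E n) : Integrable (lowerEnv x w) μ := by
  refine Integrable.mono' (((integrable_norm_sq hμ).const_mul 2).add
    (integrable_const (∑ i, 2 * ‖x i‖ ^ 2 + ‖w‖)))
    (measurable_lowerEnv_right x w).aestronglyMeasurable (ae_of_all _ fun y => ?_)
  exact abs_lowerEnv_le x w y

lemma dualFun_sub_le [NeZero n] {μ : Measure (E d)} [IsProbabilityMeasure μ]
    (hμ : ∫⁻ y, ‖y‖ₑ ^ 2 ∂μ < ∞) (x : Fin n → E d) (w w' : E n) :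
    dualFun μ x w - dualFun μ x w' ≤ 2 * ‖w - w'‖ := by
  have h1 : ∫ y, lowerEnv x w y ∂μ - ‖w - w'‖ ≤ ∫ y, lowerEnv x w' y ∂μ := by
    have := integral_mono ((integrable_lowerEnv hμ x w).sub (integrable_const ‖w - w'‖))
      (integrable_lowerEnv hμ x w') fun y => lowerEnv_sub_le x w w' y
    simpa [integral_sub (integrable_lowerEnv hμ x w) (integrable_const ‖w - w'‖)] using this
  have h2 : (n : ℝ)⁻¹ * ∑ i, w i - (n : ℝ)⁻¹ * ∑ i, w' i ≤ ‖w - w'‖ := by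
    have hn : (0 : ℝ) < n := by exact_mod_cast Nat.pos_of_ne_zero (NeZero.ne n)
    rw [← mul_sub, ← Finset.sum_sub_distrib, inv_mul_le_iff₀ hn]
    calc ∑ i, (w i - w' i) ≤ ∑ _i : Fin n, ‖w - w'‖ :=
          Finset.sum_le_sum fun i _ => (le_abs_self _).trans (abs_coord_le (w - w') i)
      _ = n * ‖w - w'‖ := by simp
  unfold dualFun
  linarith

lemma continuous_dualFun [NeZero n] {μ : Measure (E d)} [IsProbabilityMeasure μ]
    (hμ : ∫⁻ y, ‖y‖ₑ ^ 2 ∂μ < ∞) (x : Fin n → E d) : Continuous (dualFun μ x) := by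
  refine (LipschitzWith.of_dist_le_mul (K := 2) fun w w' => ?_).continuous
  rw [Real.dist_eq, dist_eq_norm, abs_le]
  have h1 := dualFun_sub_le hμ x w w'
  have h2 := dualFun_sub_le hμ x w' w
  rw [norm_sub_rev] at h2
  simp only [NNReal.coe_ofNat]
  constructor <;> linarith

lemma concaveOn_dualFun [NeZero n] {μ : Measure (E d)} [IsProbabilityMeasure μ]
    (hμ : ∫⁻ y, ‖y‖ₑ ^ 2 ∂μ < ∞) (x : Fin n → E d) : ConcaveOn ℝ Set.univ (dualFun μ x) := by
  refine ⟨convex_univ, fun w _ w' _ a b ha hb hab => ?_⟩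
  have h1 : a * ∫ y, lowerEnv x w y ∂μ + b * ∫ y, lowerEnv x w' y ∂μ
      ≤ ∫ y, lowerEnv x (a • w + b • w') y ∂μ := by
    rw [← integral_const_mul, ← integral_const_mul, ← integral_add
      ((integrable_lowerEnv hμ x w).const_mul a) ((integrable_lowerEnv hμ x w').const_mul b)]
    refine integral_mono (((integrable_lowerEnv hμ x w).const_mul a).add
      ((integrable_lowerEnv hμ x w').const_mul b)) (integrable_lowerEnv hμ x _) fun y => ?_
    refine le_lowerEnv fun i => ?_
    have e1 := mul_le_mul_of_nonneg_left (lowerEnv_le x w y i) ha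
    have e2 := mul_le_mul_of_nonneg_left (lowerEnv_le x w' y i) hb
    simp only [shiftedCost, PiLp.add_apply, PiLp.smul_apply, smul_eq_mul] at *
    have : ‖y - x i‖ ^ 2 = a * ‖y - x i‖ ^ 2 + b * ‖y - x i‖ ^ 2 := by rw [← add_mul, hab, one_mul]
    linarith
  have h2 : ∑ i, (a • w + b • w') i = a * ∑ i, w i + b * ∑ i, w' i := by
    simp [Finset.sum_add_distrib, Finset.mul_sum]
  simp only [dualFun, smul_eq_mul, h2]
  linarith

lemma dualFun_add_const [NeZero n] {μ : Measure (E d)} [IsProbabilityMeasure μ]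
    (hμ : ∫⁻ y, ‖y‖ₑ ^ 2 ∂μ < ∞) (x : Fin n → E d) (w : E n) (c : ℝ) :
    dualFun μ x (w + WithLp.toLp 2 fun _ => c) = dualFun μ x w := by
  have hn : (n : ℝ) ≠ 0 := by exact_mod_cast NeZero.ne n
  have h1 : ∀ y, lowerEnv x (w + WithLp.toLp 2 fun _ => c) y = lowerEnv x w y - c := by
    intro y
    refine le_antisymm ?_ (le_lowerEnv fun i => ?_)
    · obtain ⟨i, hi⟩ := exists_shiftedCost_eq_lowerEnv x w y
      refine (lowerEnv_le _ _ y i).trans_eq ?_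
      rw [← hi]; simp only [shiftedCost, PiLp.add_apply]; ring
    · have := lowerEnv_le x w y i
      simp only [shiftedCost, PiLp.add_apply] at *
      linarith
  simp only [dualFun, h1]
  rw [integral_sub (integrable_lowerEnv hμ x w) (integrable_const c)]
  simp only [integral_const, probReal_univ, smul_eq_mul, one_mul, PiLp.add_apply,
    Finset.sum_add_distrib, Finset.sum_const, Finset.card_univ, Fintype.card_fin, nsmul_eq_mul]
  field_simp
  ring

/-- The dual functional attains its maximum. It is invariant under adding a constant to all the
prices, so one may assume that the largest price is `0`; among such prices it tends to `-∞`. -/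
lemma exists_forall_dualFun_le [NeZero n] {μ : Measure (E d)} [IsProbabilityMeasure μ]
    (hμ : ∫⁻ y, ‖y‖ₑ ^ 2 ∂μ < ∞) (x : Fin n → E d) : ∃ w, ∀ w', dualFun μ x w' ≤ dualFun μ x w := by
  have hn : (0 : ℝ) < n := by exact_mod_cast Nat.pos_of_ne_zero (NeZero.ne n)
  have hint : ∀ i, Integrable (fun y => ‖y - x i‖ ^ 2) μ := fun i => by
    refine Integrable.mono' (((integrable_norm_sq hμ).const_mul 2).add
      (integrable_const (2 * ‖x i‖ ^ 2))) (by fun_prop) (ae_of_all _ fun y => ?_)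
    rw [Real.norm_of_nonneg (by positivity)]
    exact norm_sub_sq_le y (x i)
  set C := ∑ i, ∫ y, ‖y - x i‖ ^ 2 ∂μ with hC
  have hnn : ∀ i, 0 ≤ ∫ y, ‖y - x i‖ ^ 2 ∂μ := fun i => integral_nonneg fun y => by positivity
  -- if some price is `0`, the dual functional is at most `C` plus the mean price
  have hbound : ∀ w : E n, (∃ i, w i = 0) → dualFun μ x w ≤ C + (n : ℝ)⁻¹ * ∑ i, w i := by
    rintro w ⟨i, hi⟩
    refine add_le_add_left ?_ _
    refine (integral_mono (integrable_lowerEnv hμ x w) (hint i) fun y => ?_).trans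
      (Finset.single_le_sum (f := fun i => ∫ y, ‖y - x i‖ ^ 2 ∂μ) (fun i _ => hnn i)
        (Finset.mem_univ i))
    have := lowerEnv_le x w y i
    simpa [shiftedCost, hi] using this
  set R := n * (C - dualFun μ x 0) with hR
  have hR0 : 0 ≤ R := by
    have := hbound 0 ⟨0, by simp⟩
    simp at this
    have : 0 ≤ C - dualFun μ x 0 := by linarith
    positivity
  let B : Set (E n) := {w | ∀ i, w i ∈ Set.Icc (-R) 0}
  have hBc : IsCompact B := by
    refine Metric.isCompact_of_isClosed_isBounded ?_ ?_
    · have : B = ⋂ i, (fun w : E n => w i) ⁻¹' Set.Icc (-R) 0 := by ext; simp [B]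
      rw [this]
      exact isClosed_iInter fun i => isClosed_Icc.preimage (by fun_prop)
    · refine (Metric.isBounded_closedBall (x := (0 : E n)) (r := √(n * R ^ 2))).subset fun w hw => ?_
      rw [mem_closedBall_zero_iff, EuclideanSpace.norm_eq]
      refine Real.sqrt_le_sqrt ?_
      calc ∑ i, ‖w i‖ ^ 2 ≤ ∑ _i : Fin n, R ^ 2 := Finset.sum_le_sum fun i _ => by
            rw [Real.norm_eq_abs, sq_abs]
            have := hw i
            nlinarith [this.1, this.2]
        _ = n * R ^ 2 := by simp
  have h0 : (0 : E n) ∈ B := fun i => by simp [hR0]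
  obtain ⟨w, -, hw⟩ := hBc.exists_isMaxOn ⟨0, h0⟩ (continuous_dualFun hμ x).continuousOn
  refine ⟨w, fun w' => ?_⟩
  obtain ⟨i0, hi0⟩ : ∃ i, w' i = ⨆ j, w' j := exists_eq_ciSup_of_finite
  have hle : ∀ j, w' j ≤ w' i0 := fun j => hi0 ▸ le_ciSup (Set.finite_range _).bddAbove j
  rw [← dualFun_add_const hμ x w' (-(w' i0))]
  set v : E n := w' + WithLp.toLp 2 fun _ => -(w' i0) with hv
  have hv0 : v i0 = 0 := by simp [hv]
  have hvle : ∀ j, v j ≤ 0 := fun j => by simp [hv, hle j]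
  by_cases hvB : v ∈ B
  · exact hw hvB
  · obtain ⟨j, hj⟩ : ∃ j, v j < -R := by
      by_contra! hcon
      exact hvB fun i => ⟨hcon i, hvle i⟩
    have h1 := hbound v ⟨i0, hv0⟩
    have h2 : ∑ i, v i ≤ v j := by
      have := Finset.single_le_sum (f := fun i => -v i) (fun i _ => neg_nonneg.2 (hvle i))
        (Finset.mem_univ j)
      rw [Finset.sum_neg_distrib] at this
      linarith
    have h3 : (n : ℝ)⁻¹ * ∑ i, v i ≤ (n : ℝ)⁻¹ * (-R) :=
      mul_le_mul_of_nonneg_left (by linarith) (by positivity)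
    have h4 : (n : ℝ)⁻¹ * (-R) = dualFun μ x 0 - C := by
      rw [hR]; field_simp; ring
    have h5 : dualFun μ x 0 ≤ dualFun μ x w := hw h0
    linarith

/-- At a maximum of the dual functional, for every set `J` of indices, the region where the lower
envelope is attained at an index in `J` has measure at least `|J| / n`. This is the first order
condition for raising the prices in `J`. -/
lemma card_div_le_measure_cells [NeZero n] {μ : Measure (E d)} [IsProbabilityMeasure μ]
    (hμ : ∫⁻ y, ‖y‖ₑ ^ 2 ∂μ < ∞) {x : Fin n → E d} {w : E n}
    (hw : ∀ w', dualFun μ x w' ≤ dualFun μ x w) (J : Finset (Fin n)) :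
    ENNReal.ofReal ((n : ℝ)⁻¹ * J.card) ≤
      μ {y | ∃ i ∈ J, shiftedCost x w y i = lowerEnv x w y} := by
  classical
  let A : ℝ → Set (E d) := fun ε => {y | ∃ i ∈ J, shiftedCost x w y i ≤ lowerEnv x w y + ε}
  have hAm : ∀ ε, MeasurableSet (A ε) := fun ε => by
    have : A ε = ⋃ i ∈ J, {y | shiftedCost x w y i ≤ lowerEnv x w y + ε} := by
      ext; simp [A]
    rw [this]
    refine Finset.measurableSet_biUnion _ fun i _ => measurableSet_le ?_ ?_
    · unfold shiftedCost
      fun_prop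
    · exact (measurable_lowerEnv_right x w).add_const ε
  have hε : ∀ ε, 0 < ε → ENNReal.ofReal ((n : ℝ)⁻¹ * J.card) ≤ μ (A ε) := by
    intro ε hε
    set w' : E n := w + WithLp.toLp 2 fun i => if i ∈ J then ε else 0 with hw'
    have h1 : ∀ y, lowerEnv x w y - ε * (A ε).indicator 1 y ≤ lowerEnv x w' y := by
      intro y
      refine le_lowerEnv fun i => ?_
      have hi := lowerEnv_le x w y i
      have hind : 0 ≤ (A ε).indicator (1 : E d → ℝ) y := Set.indicator_nonneg (by simp) y
      by_cases hiJ : i ∈ J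
      · by_cases hy : y ∈ A ε
        · simp only [shiftedCost, hw', PiLp.add_apply, hiJ, if_true, Set.indicator_of_mem hy,
            Pi.one_apply] at *
          linarith
        · have h3 : lowerEnv x w y + ε < shiftedCost x w y i := by
            by_contra! hcon
            exact hy ⟨i, hiJ, hcon⟩
          simp only [shiftedCost, hw', PiLp.add_apply, hiJ, if_true,
            Set.indicator_of_notMem hy] at *
          linarith
      · simp only [shiftedCost, hw', PiLp.add_apply, hiJ, if_false] at *
        nlinarith
    have hI : Integrable ((A ε).indicator (1 : E d → ℝ)) μ :=
      (integrable_const (1 : ℝ)).indicator (hAm ε)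
    have h2 : ∫ y, lowerEnv x w y ∂μ - ε * μ.real (A ε) ≤ ∫ y, lowerEnv x w' y ∂μ := by
      have := integral_mono ((integrable_lowerEnv hμ x w).sub (hI.const_mul ε))
        (integrable_lowerEnv hμ x w') h1
      rwa [integral_sub' (integrable_lowerEnv hμ x w) (hI.const_mul ε), integral_const_mul,
        integral_indicator_one (hAm ε)] at this
    have h3 : ∑ i, w' i = ∑ i, w i + J.card * ε := by
      simp [hw', Finset.sum_add_distrib]
    have h4 := hw w'
    simp only [dualFun, h3, mul_add] at h4
    have h5 : ε * ((n : ℝ)⁻¹ * J.card) ≤ ε * μ.real (A ε) := by linarith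
    have h6 := le_of_mul_le_mul_left h5 hε
    exact (ENNReal.ofReal_le_ofReal h6).trans_eq (ofReal_measureReal)
  have hlim := tendsto_measure_iInter_atTop (μ := μ) (s := fun k : ℕ => A (1 / ((k : ℝ) + 1)))
    (fun k => (hAm _).nullMeasurableSet)
    (fun k l hkl y ⟨i, hi, h⟩ => ⟨i, hi, h.trans (by
      have := Nat.one_div_le_one_div (α := ℝ) hkl
      linarith)⟩) ⟨0, measure_ne_top _ _⟩
  refine (ge_of_tendsto' hlim fun k => hε _ (by positivity)).trans (measure_mono fun y hy => ?_)
  by_contra hcon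
  have hlt : ∀ i ∈ J, ∀ᶠ k : ℕ in atTop, lowerEnv x w y + 1 / ((k : ℝ) + 1) < shiftedCost x w y i := by
    intro i hi
    have h1 : lowerEnv x w y < shiftedCost x w y i :=
      lt_of_le_of_ne (lowerEnv_le x w y i) fun h => hcon ⟨i, hi, h.symm⟩
    have h2 : Tendsto (fun k : ℕ => lowerEnv x w y + 1 / ((k : ℝ) + 1)) atTop
        (𝓝 (lowerEnv x w y + 0)) := tendsto_one_div_add_atTop_nhds_zero_nat.const_add _
    rw [add_zero] at h2
    exact h2.eventually_lt_const h1
  obtain ⟨k, hk⟩ := ((Finset.eventually_all J).2 hlt).exists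
  obtain ⟨i, hi, h⟩ := Set.mem_iInter.1 hy k
  exact absurd h (not_le.2 (hk i hi))

/-- Optimal prices of coinciding target points are equal: each cell has positive mass, hence is
nonempty, and the two shifted costs differ by a constant. -/
lemma price_eq_of_target_eq [NeZero n] {μ : Measure (E d)} [IsProbabilityMeasure μ]
    (hμ : ∫⁻ y, ‖y‖ₑ ^ 2 ∂μ < ∞) {x : Fin n → E d} {w : E n}
    (hw : ∀ w', dualFun μ x w' ≤ dualFun μ x w) {i j : Fin n} (hij : x i = x j) : w i = w j := by
  have hn : (0 : ℝ) < n := by exact_mod_cast Nat.pos_of_ne_zero (NeZero.ne n)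
  have key : ∀ i j, x i = x j → w j ≤ w i := by
    intro i j hij
    have h := card_div_le_measure_cells hμ hw {i}
    have hpos : 0 < μ {y | ∃ k ∈ ({i} : Finset (Fin n)), shiftedCost x w y k = lowerEnv x w y} :=
      lt_of_lt_of_le (ENNReal.ofReal_pos.2 (by simp [hn])) h
    obtain ⟨y, k, hk, hy⟩ := nonempty_of_measure_ne_zero hpos.ne'
    rw [Finset.mem_singleton] at hk
    subst hk
    have := lowerEnv_le x w y j
    rw [← hy, shiftedCost, shiftedCost, hij] at this
    linarith
  exact le_antisymm (key j i hij.symm) (key i j hij)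

/-- Outside a Lebesgue null set, all the indices at which the lower envelope is attained have the
same target point: a tie between different targets forces `y` to lie on a hyperplane. -/
lemma ae_unique_target (x : Fin n → E d) (w : E n) :
    ∀ᵐ y ∂(volume : Measure (E d)), ∀ i j, shiftedCost x w y i = lowerEnv x w y →
      shiftedCost x w y j = lowerEnv x w y → x i = x j := by
  rw [ae_all_iff]; intro i
  rw [ae_all_iff]; intro j
  by_cases hij : x i = x j
  · exact ae_of_all _ fun _ _ _ => hij
  set s : AffineSubspace ℝ (E d) := AffineSubspace.comap
    (innerSL ℝ (x j - x i)).toLinearMap.toAffineMap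
    (AffineSubspace.mk' ((‖x j‖ ^ 2 - w j - ‖x i‖ ^ 2 + w i) / 2) ⊥) with hs
  have hmem : ∀ y, y ∈ s ↔ inner ℝ (x j - x i) y = (‖x j‖ ^ 2 - w j - ‖x i‖ ^ 2 + w i) / 2 := by
    intro y
    simp [hs, AffineSubspace.mem_mk', sub_eq_zero, inner_sub_left]
  have hne : s ≠ ⊤ := by
    intro htop
    have h0 := (hmem 0).1 (htop ▸ AffineSubspace.mem_top ℝ (E d) 0)
    have h1 := (hmem (x j - x i)).1 (htop ▸ AffineSubspace.mem_top ℝ (E d) _)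
    rw [inner_zero_right] at h0
    rw [← h0, inner_self_eq_zero, sub_eq_zero] at h1
    exact hij h1.symm
  filter_upwards [measure_eq_zero_iff_ae_notMem.1 (Measure.addHaar_affineSubspace volume s hne)]
    with y hy hi hj
  exfalso
  apply hy
  rw [SetLike.mem_coe, hmem]
  have h := hi.trans hj.symm
  simp only [shiftedCost, norm_sub_sq_real] at h
  rw [inner_sub_left, real_inner_comm y (x j), real_inner_comm y (x i)]
  linarith

/-! ### The transport map defined by optimal prices -/

lemma argmin_nonempty [NeZero n] (x : Fin n → E d) (w : E n) (y : E d) :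
    (Finset.univ.filter fun i => shiftedCost x w y i = lowerEnv x w y).Nonempty := by
  obtain ⟨i, hi⟩ := exists_shiftedCost_eq_lowerEnv x w y
  exact ⟨i, by simp [hi]⟩

/-- The first index at which the lower envelope is attained. -/
def argminIdx [NeZero n] (x : Fin n → E d) (w : E n) (y : E d) : Fin n :=
  (Finset.univ.filter fun i => shiftedCost x w y i = lowerEnv x w y).min' (argmin_nonempty x w y)

/-- The map sending `y` to the target point whose shifted cost is smallest. -/
def targetMap [NeZero n] (x : Fin n → E d) (w : E n) (y : E d) : E d := x (argminIdx x w y)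

lemma shiftedCost_argminIdx [NeZero n] (x : Fin n → E d) (w : E n) (y : E d) :
    shiftedCost x w y (argminIdx x w y) = lowerEnv x w y := by
  exact (Finset.mem_filter.1 (Finset.min'_mem _ (argmin_nonempty x w y))).2

lemma argminIdx_eq_iff [NeZero n] (x : Fin n → E d) (w : E n) (y : E d) (i : Fin n) :
    argminIdx x w y = i ↔ shiftedCost x w y i = lowerEnv x w y ∧
      ∀ j < i, shiftedCost x w y j ≠ lowerEnv x w y := by
  have hmin : ∀ j, shiftedCost x w y j = lowerEnv x w y → argminIdx x w y ≤ j := fun j hj =>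
    Finset.min'_le _ _ (by simp [hj])
  constructor
  · rintro rfl
    exact ⟨shiftedCost_argminIdx x w y, fun j hj h => absurd (hmin j h) (not_le.2 hj)⟩
  · rintro ⟨hi, hlt⟩
    refine le_antisymm (hmin i hi) (not_lt.1 fun h => hlt _ h (shiftedCost_argminIdx x w y))

lemma measurable_targetMap [NeZero n] :
    Measurable fun q : ((Fin n → E d) × E n) × E d => targetMap q.1.1 q.1.2 q.2 := by
  have hidx : Measurable fun q : ((Fin n → E d) × E n) × E d => argminIdx q.1.1 q.1.2 q.2 := by
    refine measurable_to_countable' fun i => ?_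
    have : (fun q : ((Fin n → E d) × E n) × E d => argminIdx q.1.1 q.1.2 q.2) ⁻¹' {i} =
        {q | shiftedCost q.1.1 q.1.2 q.2 i = lowerEnv q.1.1 q.1.2 q.2} ∩
          ⋂ j, ⋂ (_ : j < i), {q | shiftedCost q.1.1 q.1.2 q.2 j = lowerEnv q.1.1 q.1.2 q.2}ᶜ := by
      ext q
      simp [argminIdx_eq_iff]
    rw [this]
    have hm : ∀ j, MeasurableSet {q : ((Fin n → E d) × E n) × E d |
        shiftedCost q.1.1 q.1.2 q.2 j = lowerEnv q.1.1 q.1.2 q.2} := fun j =>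
      measurableSet_eq_fun (measurable_shiftedCost j) measurable_lowerEnv
    exact (hm i).inter (MeasurableSet.iInter fun j => MeasurableSet.iInter fun _ => (hm j).compl)
  have heval : Measurable fun p : (Fin n → E d) × Fin n => p.1 p.2 :=
    measurable_from_prod_countable_left fun i => measurable_pi_apply i
  exact heval.comp ((measurable_fst.comp measurable_fst).prodMk hidx)

lemma measurable_targetMap_right [NeZero n] (x : Fin n → E d) (w : E n) :
    Measurable (targetMap x w) := by
  have h : Measurable fun y : E d => ((x, w), y) := measurable_prodMk_left
  exact measurable_targetMap.comp h

instance isProbabilityMeasure_empirical [NeZero n] (x : Fin n → E d) :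
    IsProbabilityMeasure (empirical x) := by
  refine ⟨?_⟩
  have hn : (n : ℝ≥0∞) ≠ 0 := by exact_mod_cast NeZero.ne n
  simp [empirical, ENNReal.inv_mul_cancel hn (ENNReal.natCast_ne_top n)]

lemma ae_empirical_mem_range (x : Fin n → E d) : ∀ᵐ z ∂(empirical x), z ∈ Set.range x := by
  have h : MeasurableSet (Set.range x)ᶜ := (Set.finite_range x).measurableSet.compl
  rw [ae_iff]
  change empirical x (Set.range x)ᶜ = 0
  simp [empirical, Measure.dirac_apply' _ h]

lemma empirical_apply [NeZero n] (x : Fin n → E d) {B : Set (E d)} (hB : MeasurableSet B)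
    [DecidablePred fun i => x i ∈ B] :
    empirical x B = ENNReal.ofReal ((n : ℝ)⁻¹ * (Finset.univ.filter fun i => x i ∈ B).card) := by
  have hn : (0 : ℝ) < n := by exact_mod_cast Nat.pos_of_ne_zero (NeZero.ne n)
  rw [ENNReal.ofReal_mul (by positivity), ENNReal.ofReal_inv_of_pos hn, ENNReal.ofReal_natCast,
    ENNReal.ofReal_natCast]
  simp [empirical, Measure.dirac_apply' _ hB, Set.indicator_apply]

/-- For optimal prices, the target map transports `μ` to the empirical measure. -/
lemma map_targetMap [NeZero n] {μ : Measure (E d)} [IsProbabilityMeasure μ]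
    (hvol : μ ≪ volume) (hμ : ∫⁻ y, ‖y‖ₑ ^ 2 ∂μ < ∞) {x : Fin n → E d} {w : E n}
    (hw : ∀ w', dualFun μ x w' ≤ dualFun μ x w) : μ.map (targetMap x w) = empirical x := by
  classical
  have hT := measurable_targetMap_right x w
  have : IsProbabilityMeasure (μ.map (targetMap x w)) :=
    Measure.isProbabilityMeasure_map hT.aemeasurable
  refine (Measure.eq_of_le_of_measure_univ_eq ?_ (by simp)).symm
  refine Measure.le_iff.2 fun B hB => ?_
  rw [empirical_apply x hB, Measure.map_apply hT hB]
  refine (card_div_le_measure_cells hμ hw _).trans (measure_mono_ae ?_)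
  filter_upwards [hvol.ae_le (ae_unique_target x w)] with y hy
  rintro ⟨i, hi, h⟩
  have := hy i _ h (shiftedCost_argminIdx x w y)
  change targetMap x w y ∈ B
  rw [targetMap, ← this]
  simpa using hi

lemma integrable_cost [NeZero n] {μ : Measure (E d)} [IsProbabilityMeasure μ]
    (hμ : ∫⁻ y, ‖y‖ₑ ^ 2 ∂μ < ∞) {x : Fin n → E d} {π : Measure (E d × E d)}
    (hπ : IsPlan μ (empirical x) π) : Integrable (fun q : E d × E d => ‖q.1 - q.2‖ ^ 2) π := by
  have h1 : Integrable (fun q : E d × E d => ‖q.1‖ ^ 2) π := by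
    have := integrable_norm_sq hμ
    rw [← hπ.1] at this
    exact this.comp_measurable measurable_fst
  have hfin : IsProbabilityMeasure π := by
    refine ⟨?_⟩
    have := congrArg (fun m => m Set.univ) hπ.1
    simpa [Measure.map_apply measurable_fst MeasurableSet.univ] using this
  refine Integrable.mono' ((h1.const_mul 2).add
    (integrable_const (∑ i, 2 * ‖x i‖ ^ 2))) (by fun_prop) ?_
  have h2 : ∀ᵐ q ∂π, q.2 ∈ Set.range x :=
    ae_of_ae_map measurable_snd.aemeasurable (hπ.2 ▸ ae_empirical_mem_range x)
  filter_upwards [h2] with q ⟨i, hi⟩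
  rw [Real.norm_of_nonneg (by positivity)]
  refine (norm_sub_sq_le q.1 q.2).trans (add_le_add le_rfl ?_)
  rw [← hi]
  exact Finset.single_le_sum (f := fun i => 2 * ‖x i‖ ^ 2) (fun _ _ => by positivity)
    (Finset.mem_univ i)

lemma cost_eq_ofReal {π : Measure (E d × E d)}
    (h : Integrable (fun q : E d × E d => ‖q.1 - q.2‖ ^ 2) π) :
    cost π = ENNReal.ofReal (∫ q, ‖q.1 - q.2‖ ^ 2 ∂π) := by
  rw [ofReal_integral_eq_lintegral_ofReal h (ae_of_all _ fun q => by positivity), cost]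
  refine lintegral_congr fun q => ?_
  rw [ENNReal.ofReal_pow (norm_nonneg _), ofReal_norm]

/-- A measurable function on `ℝ^d` whose value at the target point `x i` is the price `w i`. -/
lemma exists_measurable_price {x : Fin n → E d} {w : E n} (h : ∀ i j, x i = x j → w i = w j) :
    ∃ v : E d → ℝ, Measurable v ∧ ∀ i, v (x i) = w i := by
  refine ⟨Function.extend x (fun i => w i) 0, ?_, fun i =>
    Function.FactorsThrough.extend_apply (g := fun i => w i) (fun i j hij => h i j hij) 0 i⟩
  refine measurable_of_restrict_of_restrict_compl (s := Set.range x)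
    (Set.finite_range x).measurableSet ?_ ?_
  · have : Finite (Set.range x) := Set.finite_range x
    exact measurable_of_countable _
  · have : (Set.range x)ᶜ.domRestrict (Function.extend x (fun i => w i) 0) = fun _ => 0 := by
      ext z
      exact Function.extend_apply' _ _ _ fun ⟨i, hi⟩ => z.2 ⟨i, hi⟩
    rw [this]
    exact measurable_const

/-- **Semi-discrete Brenier theorem.** For optimal prices, the target map is the Brenier map from
`μ` to the empirical measure. With `v` the price as a function of the target point, the
function `|y - z|² - lowerEnv y - v z` is nonnegative on the support of every plan; its integral is
the excess cost of the plan, and it vanishes almost surely only for the plan of the target map. -/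
theorem isBrenierMap_targetMap [NeZero n] {μ : Measure (E d)} [IsProbabilityMeasure μ]
    (hvol : μ ≪ volume) (hμ : ∫⁻ y, ‖y‖ₑ ^ 2 ∂μ < ∞) {x : Fin n → E d} {w : E n}
    (hw : ∀ w', dualFun μ x w' ≤ dualFun μ x w) :
    IsBrenierMap μ (empirical x) (targetMap x w) := by
  have hT := measurable_targetMap_right x w
  have hTm : Measurable fun y => (y, targetMap x w y) := measurable_id.prodMk hT
  obtain ⟨v, hvm, hv⟩ := exists_measurable_price (x := x) (w := w)
    fun i j => price_eq_of_target_eq hμ hw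
  have hvint : Integrable v (empirical x) := by
    refine Integrable.mono' (integrable_const (∑ i, |w i|)) hvm.aestronglyMeasurable ?_
    filter_upwards [ae_empirical_mem_range x] with z ⟨i, hi⟩
    rw [← hi, hv, Real.norm_eq_abs]
    exact Finset.single_le_sum (f := fun i => |w i|) (fun _ _ => abs_nonneg _) (Finset.mem_univ i)
  set gap : E d × E d → ℝ := fun q => ‖q.1 - q.2‖ ^ 2 - lowerEnv x w q.1 - v q.2 with hgap
  set K := ∫ y, lowerEnv x w y ∂μ + ∫ z, v z ∂(empirical x) with hK
  have hplan : IsPlan μ (empirical x) (μ.map fun y => (y, targetMap x w y)) := by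
    constructor
    · rw [Measure.map_map measurable_fst hTm]
      exact Measure.map_id
    · rw [Measure.map_map measurable_snd hTm]
      exact map_targetMap hvol hμ hw
  have hcalc : ∀ π, IsPlan μ (empirical x) π → 0 ≤ᵐ[π] gap ∧ Integrable gap π ∧
      ∫ q, ‖q.1 - q.2‖ ^ 2 ∂π = ∫ q, gap q ∂π + K := by
    intro π hπ
    have i1 := integrable_cost hμ hπ
    have i2 : Integrable (fun q : E d × E d => lowerEnv x w q.1) π := by
      have := integrable_lowerEnv hμ x w
      rw [← hπ.1] at this
      exact this.comp_measurable measurable_fst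
    have i3 : Integrable (fun q : E d × E d => v q.2) π := by
      have := hvint
      rw [← hπ.2] at this
      exact this.comp_measurable measurable_snd
    have e2 : ∫ q, lowerEnv x w q.1 ∂π = ∫ y, lowerEnv x w y ∂μ := by
      conv_rhs => rw [← hπ.1]
      rw [integral_map measurable_fst.aemeasurable
        (measurable_lowerEnv_right x w).aestronglyMeasurable]
    have e3 : ∫ q, v q.2 ∂π = ∫ z, v z ∂(empirical x) := by
      conv_rhs => rw [← hπ.2]
      rw [integral_map measurable_snd.aemeasurable hvm.aestronglyMeasurable]
    refine ⟨?_, (i1.sub i2).sub i3, ?_⟩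
    · have h2 : ∀ᵐ q ∂π, q.2 ∈ Set.range x :=
        ae_of_ae_map measurable_snd.aemeasurable (hπ.2 ▸ ae_empirical_mem_range x)
      filter_upwards [h2] with q ⟨i, hi⟩
      have := lowerEnv_le x w q.1 i
      simp only [Pi.zero_apply, hgap, ← hi, hv]
      simp only [shiftedCost] at this
      linarith
    · have : ∫ q, gap q ∂π =
          ∫ q, ‖q.1 - q.2‖ ^ 2 ∂π - ∫ q, lowerEnv x w q.1 ∂π - ∫ q, v q.2 ∂π := by
        rw [← integral_sub i1 i2]
        exact integral_sub (i1.sub i2) i3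
      rw [this, e2, e3, hK]
      ring
  have hzero : ∫ q, gap q ∂(μ.map fun y => (y, targetMap x w y)) = 0 := by
    rw [integral_map hTm.aemeasurable (hcalc _ hplan).2.1.aestronglyMeasurable]
    refine integral_eq_zero_of_ae (ae_of_all _ fun y => ?_)
    have := shiftedCost_argminIdx x w y
    simp only [shiftedCost] at this
    simp only [hgap, targetMap, hv, Pi.zero_apply, ← this]
    ring
  refine ⟨hT, ⟨hplan, fun π hπ => ?_⟩, fun π hπ => ?_⟩
  · rw [cost_eq_ofReal (integrable_cost hμ hplan), cost_eq_ofReal (integrable_cost hμ hπ)]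
    refine ENNReal.ofReal_le_ofReal ?_
    rw [(hcalc _ hplan).2.2, (hcalc _ hπ).2.2, hzero]
    have := integral_nonneg_of_ae (hcalc _ hπ).1
    linarith
  · have hle := hπ.2 _ hplan
    rw [cost_eq_ofReal (integrable_cost hμ hplan), cost_eq_ofReal (integrable_cost hμ hπ.1),
      ENNReal.ofReal_le_ofReal_iff (integral_nonneg fun q => by positivity),
      (hcalc _ hplan).2.2, (hcalc _ hπ.1).2.2, hzero] at hle
    have hgz : ∫ q, gap q ∂π = 0 :=
      le_antisymm (by linarith) (integral_nonneg_of_ae (hcalc _ hπ.1).1)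
    rw [integral_eq_zero_iff_of_nonneg_ae (hcalc _ hπ.1).1 (hcalc _ hπ.1).2.1] at hgz
    have hu : ∀ᵐ q ∂π, ∀ i j, shiftedCost x w q.1 i = lowerEnv x w q.1 →
        shiftedCost x w q.1 j = lowerEnv x w q.1 → x i = x j :=
      ae_of_ae_map measurable_fst.aemeasurable (by
        rw [hπ.1.1]; exact hvol.ae_le (ae_unique_target x w))
    have hr : ∀ᵐ q ∂π, q.2 ∈ Set.range x :=
      ae_of_ae_map measurable_snd.aemeasurable (hπ.1.2 ▸ ae_empirical_mem_range x)
    have hgraph : (id : E d × E d → E d × E d) =ᵐ[π] fun q => (q.1, targetMap x w q.1) := by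
      filter_upwards [hgz, hu, hr] with q hq hun ⟨i, hi⟩
      refine Prod.ext rfl ?_
      change q.2 = targetMap x w q.1
      rw [targetMap, ← hun i _ ?_ (shiftedCost_argminIdx x w q.1), hi]
      simp only [hgap, Pi.zero_apply, ← hi, hv] at hq
      simp only [shiftedCost]
      linarith
    calc π = π.map id := Measure.map_id.symm
      _ = π.map (fun q => (q.1, targetMap x w q.1)) := Measure.map_congr hgraph
      _ = (π.map Prod.fst).map (fun y => (y, targetMap x w y)) := by
          rw [Measure.map_map hTm measurable_fst]; rfl
      _ = _ := by rw [hπ.1.1]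

/-- The Brenier map is determined almost everywhere by its transport plan. -/
lemma IsBrenierMap.ae_eq {μ ν : Measure (E d)} [IsFiniteMeasure μ] {S S' : E d → E d}
    (h : IsBrenierMap μ ν S) (h' : IsBrenierMap μ ν S') : S =ᵐ[μ] S' := by
  have heq : (μ.map fun x => (x, S x)) = μ.map fun x => (x, S' x) := h'.2.2 _ h.2.1
  have hm : MeasurableSet {q : E d × E d | q.2 = S' q.1} :=
    measurableSet_eq_fun measurable_snd (h'.1.comp measurable_fst)
  have h1 : ∀ᵐ q ∂(μ.map fun x => (x, S' x)), q.2 = S' q.1 :=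
    (ae_map_iff (measurable_id.prodMk h'.1).aemeasurable hm).2 (ae_of_all _ fun _ => rfl)
  rw [← heq] at h1
  exact (ae_map_iff (measurable_id.prodMk h.1).aemeasurable hm).1 h1

end SemiDiscrete

/-! ### Measurable selection of a maximizer -/

section Selection

variable {V : Type*} [NormedAddCommGroup V] [InnerProductSpace ℝ V]

/-- A concave function has at most one maximizer of smallest norm. -/
lemma eq_of_norm_le_of_maximizer {f : V → ℝ} (hf : ConcaveOn ℝ Set.univ f) {v w : V}
    (hw : ∀ u, f u ≤ f w) (hmin : ∀ u, (∀ u', f u' ≤ f u) → ‖w‖ ≤ ‖u‖)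
    (hv : ∀ u, f u ≤ f v) (hvw : ‖v‖ ≤ ‖w‖) : v = w := by
  have hmid : ∀ u, f u ≤ f ((2⁻¹ : ℝ) • v + (2⁻¹ : ℝ) • w) := by
    intro u
    have h := hf.2 (Set.mem_univ v) (Set.mem_univ w) (show (0 : ℝ) ≤ 2⁻¹ by norm_num)
      (show (0 : ℝ) ≤ 2⁻¹ by norm_num) (by norm_num)
    have h1 := hv u
    have h2 := hw u
    simp only [smul_eq_mul] at h
    linarith
  have h1 := hmin _ hmid
  have h2 := parallelogram_law_with_norm ℝ v w
  rw [← smul_add, norm_smul, Real.norm_of_nonneg (by norm_num)] at h1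
  have h3 : ‖v - w‖ = 0 := by
    have := norm_nonneg (v - w)
    nlinarith [norm_nonneg v, norm_nonneg w, norm_nonneg (v + w)]
  exact sub_eq_zero.1 (norm_eq_zero.1 h3)

/-- If `u k` maximizes `f - ε k |·|²` up to `ε k ^ 2` and `ε k → 0`, then `u` converges to the
maximizer of `f` of smallest norm. -/
lemma tendsto_of_penalized [FiniteDimensional ℝ V] {f : V → ℝ} (hcont : Continuous f)
    (hf : ConcaveOn ℝ Set.univ f) {w : V} (hw : ∀ u, f u ≤ f w)
    (hmin : ∀ u, (∀ u', f u' ≤ f u) → ‖w‖ ≤ ‖u‖) {ε : ℕ → ℝ} (hε : ∀ k, 0 < ε k)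
    (hε0 : Tendsto ε atTop (𝓝 0)) {u : ℕ → V}
    (hu : ∀ k, f w - ε k * ‖w‖ ^ 2 - ε k ^ 2 ≤ f (u k) - ε k * ‖u k‖ ^ 2) :
    Tendsto u atTop (𝓝 w) := by
  have hnorm : ∀ k, ‖u k‖ ^ 2 ≤ ‖w‖ ^ 2 + ε k := by
    intro k
    have h1 := hu k
    have h2 := hw (u k)
    have h3 : ε k * ‖u k‖ ^ 2 ≤ ε k * (‖w‖ ^ 2 + ε k) := by nlinarith
    exact le_of_mul_le_mul_left h3 (hε k)
  have hval : ∀ k, f w - ε k * ‖w‖ ^ 2 - ε k ^ 2 ≤ f (u k) := fun k =>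
    (hu k).trans (by have := mul_nonneg (hε k).le (sq_nonneg ‖u k‖); linarith)
  obtain ⟨C, hC⟩ := hε0.bddAbove_range
  have hbdd : ∀ k, u k ∈ Metric.closedBall (0 : V) (√(‖w‖ ^ 2 + C)) := by
    intro k
    rw [mem_closedBall_zero_iff]
    exact Real.le_sqrt_of_sq_le ((hnorm k).trans (by have := hC ⟨k, rfl⟩; linarith))
  refine tendsto_of_subseq_tendsto fun ns hns => ?_
  have : ProperSpace V := FiniteDimensional.proper_real V
  obtain ⟨v, -, φ, hφ, hv⟩ :=
    (isCompact_closedBall (0 : V) (√(‖w‖ ^ 2 + C))).tendsto_subseq fun k => hbdd (ns k)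
  refine ⟨φ, ?_⟩
  have hε' : Tendsto (fun k => ε (ns (φ k))) atTop (𝓝 0) :=
    hε0.comp (hns.comp hφ.tendsto_atTop)
  have h1 : f w ≤ f v := by
    have ha : Tendsto (fun k => f w - ε (ns (φ k)) * ‖w‖ ^ 2 - ε (ns (φ k)) ^ 2) atTop
        (𝓝 (f w - 0 * ‖w‖ ^ 2 - 0 ^ 2)) :=
      (tendsto_const_nhds.sub (hε'.mul_const _)).sub (hε'.pow 2)
    have hb := (hcont.tendsto v).comp hv
    simpa using le_of_tendsto_of_tendsto' ha hb fun k => hval (ns (φ k))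
  have h2 : ‖v‖ ^ 2 ≤ ‖w‖ ^ 2 + 0 :=
    le_of_tendsto_of_tendsto' (hv.norm.pow 2) (hε'.const_add _) fun k => hnorm (ns (φ k))
  have h3 : ‖v‖ ≤ ‖w‖ := abs_le_of_sq_le_sq' (by simpa using h2) (norm_nonneg _) |>.2
  have := eq_of_norm_le_of_maximizer hf hw hmin (fun u => (hw u).trans h1) h3
  exact this ▸ hv

/-- **Measurable selection of a maximizer.** Let `F z` be concave, continuous and attain its
maximum for every `z` satisfying `good z`, and let `z ↦ F z w` be measurable for every `w`. Then a
maximizer of `F z` can be chosen measurably in `z`. The selected maximizer is the one of smallest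
norm: it is the limit of approximate maximizers, within a countable dense set, of `F z` penalized
by a small multiple of the squared norm. -/
theorem exists_measurable_maximizer {m : ℕ} {Z : Type*} [MeasurableSpace Z] {F : Z → E m → ℝ}
    (hF : ∀ w, Measurable fun z => F z w) {good : Z → Prop}
    (hcont : ∀ z, good z → Continuous (F z)) (hconc : ∀ z, good z → ConcaveOn ℝ Set.univ (F z))
    (hmax : ∀ z, good z → ∃ w, ∀ w', F z w' ≤ F z w) :
    ∃ s : Z → E m, Measurable s ∧ ∀ z, good z → ∀ w, F z w ≤ F z (s z) := by
  classical
  let ε : ℕ → ℝ := fun k => 1 / ((k : ℝ) + 1)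
  have hε : ∀ k, 0 < ε k := fun k => by positivity
  let q : ℕ → E m := TopologicalSpace.denseSeq (E m)
  let G : ℕ → Z → ℕ → ℝ := fun k z j => F z (q j) - ε k * ‖q j‖ ^ 2
  have hG : ∀ k j, Measurable fun z => G k z j := fun k j => (hF _).sub_const _
  let S : ℕ → Z → ℝ := fun k z => ⨆ j, G k z j
  have hS : ∀ k, Measurable (S k) := fun k => Measurable.iSup fun j => hG k j
  let near : ℕ → Z → ℕ → Prop := fun k z j => S k z - ε k ^ 2 ≤ G k z j
  have hnear : ∀ k j, MeasurableSet {z | near k z j} := fun k j =>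
    measurableSet_le ((hS k).sub_const _) (hG k j)
  let p : ℕ → Z → ℕ → Prop := fun k z j => near k z j ∨ ∀ i, ¬ near k z i
  have hp : ∀ k z, ∃ j, p k z j := fun k z => by
    by_cases h : ∃ j, near k z j
    · exact h.imp fun j hj => Or.inl hj
    · exact ⟨0, Or.inr (not_exists.1 h)⟩
  have hpm : ∀ k j, MeasurableSet {z | p k z j} := fun k j => by
    have : {z | p k z j} = {z | near k z j} ∪ ⋂ i, {z | near k z i}ᶜ := by
      ext z; simp [p]
    rw [this]
    exact (hnear k j).union (MeasurableSet.iInter fun i => (hnear k i).compl)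
  let u : ℕ → Z → E m := fun k z => q (Nat.find (hp k z))
  have hu : ∀ k, Measurable (u k) := fun k =>
    (measurable_from_nat (f := q)).comp (measurable_find (hp k) (hpm k))
  let s : Z → E m := fun z => WithLp.toLp 2 fun i => limsup (fun k => u k z i) atTop
  have hs : Measurable s := by
    refine (WithLp.measurable_toLp 2 _).comp (measurable_pi_lambda _ fun i => ?_)
    refine Measurable.limsup fun k => ?_
    exact (measurable_pi_apply i).comp ((WithLp.measurable_ofLp 2 _).comp (hu k))
  refine ⟨s, hs, fun z hz => ?_⟩
  -- the maximizer of smallest norm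
  obtain ⟨w, hw, hmin⟩ : ∃ w, (∀ w', F z w' ≤ F z w) ∧
      ∀ v, (∀ w', F z w' ≤ F z v) → ‖w‖ ≤ ‖v‖ := by
    obtain ⟨w₁, hw₁⟩ := hmax z hz
    have hcl : IsClosed {w | ∀ w', F z w' ≤ F z w} := by
      simp only [Set.ofPred_forall]
      exact isClosed_iInter fun w' => isClosed_le continuous_const (hcont z hz)
    obtain ⟨w, hw, hdist⟩ := hcl.exists_infDist_eq_dist ⟨w₁, hw₁⟩ 0
    refine ⟨w, hw, fun v hv => ?_⟩
    have h := Metric.infDist_le_dist_of_mem (x := (0 : E m)) (s := {w | ∀ w', F z w' ≤ F z w}) hv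
    rw [hdist, dist_zero_left, dist_zero_left] at h
    exact h
  have hbdd : ∀ k, BddAbove (Set.range (G k z)) := fun k => by
    refine ⟨F z w, ?_⟩
    rintro _ ⟨j, rfl⟩
    have h1 := hw (q j)
    have h2 := mul_nonneg (hε k).le (sq_nonneg ‖q j‖)
    simp only [G]
    linarith
  have hSle : ∀ k v, F z v - ε k * ‖v‖ ^ 2 ≤ S k z := by
    intro k v
    have hc : Continuous fun v : E m => F z v - ε k * ‖v‖ ^ 2 :=
      (hcont z hz).sub (by fun_prop)
    have hcl : IsClosed {v : E m | F z v - ε k * ‖v‖ ^ 2 ≤ S k z} :=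
      isClosed_le hc continuous_const
    have hsub : Set.range q ⊆ {v : E m | F z v - ε k * ‖v‖ ^ 2 ≤ S k z} := by
      rintro _ ⟨j, rfl⟩
      exact le_ciSup (hbdd k) j
    have hdense : closure (Set.range q) = Set.univ :=
      (TopologicalSpace.denseRange_denseSeq (E m)).closure_range
    exact hcl.closure_subset_iff.2 hsub (hdense ▸ Set.mem_univ v)
  have hfind : ∀ k, near k z (Nat.find (hp k z)) := by
    intro k
    refine (Nat.find_spec (hp k z)).resolve_right fun hcon => ?_
    have hlt : S k z - ε k ^ 2 < ⨆ j, G k z j := sub_lt_self _ (pow_pos (hε k) 2)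
    obtain ⟨j, hj⟩ := exists_lt_of_lt_ciSup hlt
    exact hcon j hj.le
  have hlim : Tendsto (fun k => u k z) atTop (𝓝 w) := by
    refine tendsto_of_penalized (hcont z hz) (hconc z hz) hw hmin hε
      tendsto_one_div_add_atTop_nhds_zero_nat fun k => ?_
    have h1 := hSle k w
    have h2 : S k z - ε k ^ 2 ≤ F z (u k z) - ε k * ‖u k z‖ ^ 2 := hfind k
    linarith
  have hsw : s z = w := by
    ext i
    have : Tendsto (fun k => u k z i) atTop (𝓝 (w i)) :=
      ((PiLp.continuous_apply 2 _ i).tendsto w).comp hlim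
    exact this.limsup_eq
  exact hsw ▸ hw

end Selection

/-- The prices of the semi-discrete transport problem from a kernel `κ` to empirical measures,
and hence the Brenier map itself, can be chosen jointly measurably in the parameter of the
kernel, the target points and the space variable. -/
theorem exists_measurable_brenierMap {d n : ℕ} [NeZero n] {Y : Type*} [MeasurableSpace Y]
    (κ : Kernel Y (E d)) [IsMarkovKernel κ] :
    ∃ G : (Y × (Fin n → E d)) × E d → E d, Measurable G ∧
      ∀ t x, κ t ≪ volume → ∫⁻ y, ‖y‖ₑ ^ 2 ∂(κ t) < ∞ →
        IsBrenierMap (κ t) (empirical x) fun y => G ((t, x), y) := by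
  have hF : ∀ w : E n, Measurable fun z : Y × (Fin n → E d) => dualFun (κ z.1) z.2 w := by
    intro w
    refine Measurable.add_const ?_ _
    have hm : Measurable (Function.uncurry fun (z : Y × (Fin n → E d)) (y : E d) =>
        lowerEnv z.2 w y) := by
      unfold Function.uncurry lowerEnv shiftedCost
      fun_prop
    exact (StronglyMeasurable.integral_kernel_prod_right (κ := κ.comap Prod.fst measurable_fst)
      hm.stronglyMeasurable).measurable
  obtain ⟨s, hs, hmax⟩ := exists_measurable_maximizer hF
    (good := fun z => ∫⁻ y, ‖y‖ₑ ^ 2 ∂(κ z.1) < ∞)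
    (fun z hz => continuous_dualFun hz z.2) (fun z hz => concaveOn_dualFun hz z.2)
    (fun z hz => exists_forall_dualFun_le hz z.2)
  have h : Measurable fun q : (Y × (Fin n → E d)) × E d => ((q.1.2, s q.1), q.2) := by fun_prop
  have hG : Measurable fun q : (Y × (Fin n → E d)) × E d => targetMap q.1.2 (s q.1) q.2 :=
    measurable_targetMap.comp h
  refine ⟨_, hG, fun t x hvol hsq => ?_⟩
  have hw : ∀ w', dualFun (κ t) x w' ≤ dualFun (κ t) x (s (t, x)) := hmax (t, x) hsq
  have hB : IsBrenierMap (κ t) (empirical x) (targetMap x (s (t, x))) :=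
    isBrenierMap_targetMap hvol hsq hw
  exact hB

/-! ### Continuous adapted processes are predictable -/

/-- A continuous adapted process is predictable: it is the limit of the processes equal to `X 0`
at time `0` and to `X_{j / (k + 1)}` on the interval `(j / (k + 1), (j + 1) / (k + 1)]`. -/
lemma measurable_predictable_of_continuous {Ω : Type*} [mΩ : MeasurableSpace Ω]
    {𝓕 : Filtration ℝ≥0 mΩ} {V : Type*} [TopologicalSpace V]
    [TopologicalSpace.PseudoMetrizableSpace V] [MeasurableSpace V] [BorelSpace V]
    {X : ℝ≥0 → Ω → V} (hcont : ∀ ω, Continuous fun t => X t ω) (hX : ∀ t, Measurable[𝓕 t] (X t)) :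
    Measurable[𝓕.predictable] fun p : ℝ≥0 × Ω => X p.1 p.2 := by
  -- `⌈(k + 1) t⌉ - 1`, truncated at `0`, is the index of the interval containing `t`
  let τ : ℕ → ℝ≥0 → ℝ≥0 := fun k t => ((⌈((k : ℝ≥0) + 1) * t⌉₊ - 1 : ℕ) : ℝ≥0) / (k + 1)
  have hk : ∀ k : ℕ, (0 : ℝ≥0) < (k : ℝ≥0) + 1 := fun k => by positivity
  refine @measurable_of_tendsto_metrizable _ V 𝓕.predictable _ _ _ _
    (fun (k : ℕ) (p : ℝ≥0 × Ω) => X (τ k p.1) p.2) _ (fun k => ?_) ?_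
  · intro B hB
    have heq : (fun p : ℝ≥0 × Ω => X (τ k p.1) p.2) ⁻¹' B = ({⊥} ×ˢ (X 0 ⁻¹' B)) ∪
        ⋃ j : ℕ, Set.Ioc ((j : ℝ≥0) / (k + 1)) ((j + 1 : ℝ≥0) / (k + 1)) ×ˢ
          (X ((j : ℝ≥0) / (k + 1)) ⁻¹' B) := by
      ext ⟨t, ω⟩
      simp only [Set.mem_preimage, Set.mem_union, Set.mem_prod, Set.mem_singleton_iff,
        Set.mem_iUnion, Set.mem_Ioc]
      have hτ : ∀ j : ℕ, (j : ℝ≥0) / (k + 1) < t → t ≤ (j + 1 : ℝ≥0) / (k + 1) →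
          τ k t = (j : ℝ≥0) / (k + 1) := by
        intro j h1 h2
        rw [div_lt_iff₀ (hk k), mul_comm] at h1
        rw [le_div_iff₀ (hk k), mul_comm] at h2
        have : ⌈((k : ℝ≥0) + 1) * t⌉₊ = j + 1 := by
          rw [Nat.ceil_eq_iff (by omega)]
          exact ⟨by simpa using h1, by exact_mod_cast h2⟩
        simp [τ, this]
      constructor
      · intro h
        rcases eq_or_ne t 0 with rfl | ht
        · left
          exact ⟨rfl, by simpa [τ] using h⟩
        · right
          have hpos : 0 < ((k : ℝ≥0) + 1) * t := mul_pos (hk k) (pos_iff_ne_zero.2 ht)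
          have hc : 0 < ⌈((k : ℝ≥0) + 1) * t⌉₊ := Nat.ceil_pos.2 hpos
          obtain ⟨j, hj⟩ := Nat.exists_eq_succ_of_ne_zero hc.ne'
          have h3 := (Nat.ceil_eq_iff (Nat.succ_ne_zero j)).1 hj
          have h4 : (j : ℝ≥0) / (k + 1) < t := by
            rw [div_lt_iff₀ (hk k), mul_comm]; simpa using h3.1
          have h5 : t ≤ (j + 1 : ℝ≥0) / (k + 1) := by
            rw [le_div_iff₀ (hk k), mul_comm]; simpa using h3.2
          exact ⟨j, ⟨h4, h5⟩, hτ j h4 h5 ▸ h⟩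
      · rintro (⟨rfl, h⟩ | ⟨j, ⟨h4, h5⟩, h⟩)
        · simpa [τ] using h
        · rw [hτ j h4 h5]; exact h
    rw [heq]
    refine MeasurableSet.union (measurableSet_predictable_singleton_bot_prod (hX 0 hB))
      (MeasurableSet.iUnion fun j => measurableSet_predictable_Ioc_prod _ _ (hX _ hB))
  · rw [tendsto_pi_nhds]
    rintro ⟨t, ω⟩
    refine ((hcont ω).tendsto t).comp ?_
    rw [← NNReal.tendsto_coe]
    have hlow : ∀ k : ℕ, (t : ℝ) - 1 / ((k : ℝ) + 1) ≤ τ k t := by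
      intro k
      have hk' : (0 : ℝ) < (k : ℝ) + 1 := by positivity
      have h1 : ((k : ℝ) + 1) * t ≤ ⌈((k : ℝ≥0) + 1) * t⌉₊ := by
        exact_mod_cast Nat.le_ceil (((k : ℝ≥0) + 1) * t)
      have h2 : (⌈((k : ℝ≥0) + 1) * t⌉₊ : ℝ) ≤ ((⌈((k : ℝ≥0) + 1) * t⌉₊ - 1 : ℕ) : ℝ) + 1 := by
        exact_mod_cast (by omega : ∀ c : ℕ, c ≤ c - 1 + 1) _
      simp only [τ, NNReal.coe_div, NNReal.coe_natCast, NNReal.coe_add, NNReal.coe_one]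
      rw [sub_le_iff_le_add, ← add_div, le_div_iff₀ hk']
      linarith
    have hup : ∀ k : ℕ, (τ k t : ℝ) ≤ t := by
      intro k
      have : τ k t ≤ t := by
        simp only [τ]
        rw [div_le_iff₀ (hk k), mul_comm t]
        rcases Nat.eq_zero_or_pos ⌈((k : ℝ≥0) + 1) * t⌉₊ with h0 | h0
        · rw [h0]; simp
        · refine le_of_lt ?_
          have h := (Nat.ceil_eq_iff h0.ne').1 rfl
          exact h.1
      exact_mod_cast this
    refine tendsto_of_tendsto_of_tendsto_of_le_of_le ?_ tendsto_const_nhds hlow hup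
    simpa using tendsto_one_div_add_atTop_nhds_zero_nat.const_sub (t : ℝ)

/-! ### Increments of a white noise -/

section WhiteNoise

variable {d : ℕ} {Ω : Type*} [mΩ : MeasurableSpace Ω] {μ : Measure Ω}
  {P : Kernel ℝ≥0 (E d)} [IsMarkovKernel P] {W : Set (ℝ≥0 × E d) → Ω → E d}

/-- The increment `W^k_s(A) - W^k_u(A)` between the times `u` and `s` of the `k`-th coordinate of
a white noise, where `W_s(A) = W([0, s] × A)`. -/
def incr (W : Set (ℝ≥0 × E d) → Ω → E d) (k : Fin d) (u s : ℝ≥0) (A : Set (E d)) (ω : Ω) : ℝ :=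
  W (Set.Iic s ×ˢ A) ω k - W (Set.Iic u ×ˢ A) ω k

lemma incr_add (k : Fin d) (u v s : ℝ≥0) (A : Set (E d)) (ω : Ω) :
    incr W k u s A ω = incr W k u v A ω + incr W k v s A ω := by
  simp [incr]

lemma incr_self (k : Fin d) (u : ℝ≥0) (A : Set (E d)) (ω : Ω) : incr W k u u A ω = 0 := by
  simp [incr]

lemma memLp_noise (hW : IsWhiteNoise μ (covMeasure P) W) (k : Fin d) (s : ℝ≥0) {A : Set (E d)}
    (hA : MeasurableSet A) : MemLp (fun ω => W (Set.Iic s ×ˢ A) ω k) 2 μ :=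
  (hW.gaussian.hasGaussianLaw_eval ⟨⟨Set.Iic s ×ˢ A, measurableSet_Iic.prod hA,
    covMeasure_rect_lt_top P s hA⟩, k⟩).memLp_two

lemma memLp_incr (hW : IsWhiteNoise μ (covMeasure P) W) (k : Fin d) (u s : ℝ≥0) {A : Set (E d)}
    (hA : MeasurableSet A) : MemLp (incr W k u s A) 2 μ :=
  (memLp_noise hW k s hA).sub (memLp_noise hW k u hA)

lemma integral_incr (hW : IsWhiteNoise μ (covMeasure P) W) [IsFiniteMeasure μ] (k : Fin d)
    (u s : ℝ≥0) {A : Set (E d)} (hA : MeasurableSet A) : ∫ ω, incr W k u s A ω ∂μ = 0 := by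
  have h := fun s => hW.centered _ (measurableSet_Iic.prod hA) (covMeasure_rect_lt_top P s hA) k
  have hi := fun s => (memLp_noise hW k s hA).integrable one_le_two
  unfold incr
  rw [integral_sub (hi s) (hi u), h, h, sub_zero]

lemma measureReal_strip_inter {u s : ℝ≥0} (hus : u ≤ s) {A : Set (E d)} (hA : MeasurableSet A)
    {B : Set (ℝ≥0 × E d)} (hB : MeasurableSet B) :
    (covMeasure P).real ((Set.Ioc u s ×ˢ A) ∩ B) =
      (covMeasure P).real ((Set.Iic s ×ˢ A) ∩ B) - (covMeasure P).real ((Set.Iic u ×ˢ A) ∩ B) := by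
  have heq : (Set.Ioc u s ×ˢ A) ∩ B = ((Set.Iic s ×ˢ A) ∩ B) \ ((Set.Iic u ×ˢ A) ∩ B) := by
    ext ⟨t, y⟩
    simp only [Set.mem_inter_iff, Set.mem_prod, Set.mem_Ioc, Set.mem_Iic, Set.mem_sdiff]
    constructor
    · rintro ⟨⟨⟨h1, h2⟩, h3⟩, h4⟩
      exact ⟨⟨⟨h2, h3⟩, h4⟩, fun h => absurd h.1.1 (not_le.2 h1)⟩
    · rintro ⟨⟨⟨h2, h3⟩, h4⟩, h⟩
      exact ⟨⟨⟨not_le.1 fun h1 => h ⟨⟨h1, h3⟩, h4⟩, h2⟩, h3⟩, h4⟩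
  rw [heq, measureReal_sdiff
    (Set.inter_subset_inter_left _ (Set.prod_mono (Set.Iic_subset_Iic.2 hus) le_rfl))
    ((measurableSet_Iic.prod hA).inter hB)
    ((measure_mono Set.inter_subset_left).trans_lt (covMeasure_rect_lt_top P s hA)).ne]

lemma measureReal_strip_le {u s : ℝ≥0} (hus : u ≤ s) {A : Set (E d)} (hA : MeasurableSet A) :
    (covMeasure P).real (Set.Ioc u s ×ˢ A) ≤ s - u := by
  have h1 : covMeasure P (Set.Ioc u s ×ˢ A) ≤ timeMeasure (Set.Ioc u s) := by
    unfold covMeasure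
    rw [Measure.compProd_apply_prod measurableSet_Ioc hA]
    calc ∫⁻ a in Set.Ioc u s, P a A ∂timeMeasure
        ≤ ∫⁻ _ in Set.Ioc u s, 1 ∂timeMeasure := lintegral_mono fun _ => prob_le_one
      _ = timeMeasure (Set.Ioc u s) := by simp
  have h2 : timeMeasure (Set.Ioc u s) = ((s - u : ℝ≥0) : ℝ≥0∞) := by
    rw [← Set.Iic_sdiff_Iic, measure_sdiff (Set.Iic_subset_Iic.2 hus)
      measurableSet_Iic.nullMeasurableSet (by simp [timeMeasure_Iic]), timeMeasure_Iic,
      timeMeasure_Iic, ENNReal.coe_sub]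
  rw [h2] at h1
  have h3 := ENNReal.toReal_mono ENNReal.coe_ne_top h1
  rwa [ENNReal.coe_toReal, NNReal.coe_sub hus] at h3

lemma integral_incr_mul_noise (hW : IsWhiteNoise μ (covMeasure P) W) [IsFiniteMeasure μ]
    (k l : Fin d) {u s : ℝ≥0} (hus : u ≤ s) (v : ℝ≥0) {A B : Set (E d)} (hA : MeasurableSet A)
    (hB : MeasurableSet B) : ∫ ω, incr W k u s A ω * W (Set.Iic v ×ˢ B) ω l ∂μ =
      if k = l then (covMeasure P).real ((Set.Ioc u s ×ˢ A) ∩ (Set.Iic v ×ˢ B)) else 0 := by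
  have h := fun s => hW.covariance _ _ (measurableSet_Iic.prod hA) (covMeasure_rect_lt_top P s hA)
    (measurableSet_Iic.prod hB) (covMeasure_rect_lt_top P v hB) k l
  have hi : ∀ s, Integrable (fun ω => W (Set.Iic s ×ˢ A) ω k * W (Set.Iic v ×ˢ B) ω l) μ :=
    fun s => (memLp_noise hW k s hA).integrable_mul (memLp_noise hW l v hB)
  have e : ∀ ω, incr W k u s A ω * W (Set.Iic v ×ˢ B) ω l =
      W (Set.Iic s ×ˢ A) ω k * W (Set.Iic v ×ˢ B) ω l -
        W (Set.Iic u ×ˢ A) ω k * W (Set.Iic v ×ˢ B) ω l := fun ω => sub_mul _ _ _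
  rw [integral_congr_ae (ae_of_all _ e), integral_sub (hi s) (hi u), h, h,
    measureReal_strip_inter hus hA (measurableSet_Iic.prod hB)]
  split_ifs <;> simp [Measure.real]

lemma integral_incr_mul_incr (hW : IsWhiteNoise μ (covMeasure P) W) [IsFiniteMeasure μ]
    (k : Fin d) {u s u' s' : ℝ≥0} (hus : u ≤ s) (hus' : u' ≤ s') {A B : Set (E d)}
    (hA : MeasurableSet A) (hB : MeasurableSet B) :
    ∫ ω, incr W k u s A ω * incr W k u' s' B ω ∂μ =
      (covMeasure P).real ((Set.Ioc u s ×ˢ A) ∩ (Set.Ioc u' s' ×ˢ B)) := by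
  have h := fun v => integral_incr_mul_noise hW k k hus v hA hB
  have hi : ∀ v, Integrable (fun ω => incr W k u s A ω * W (Set.Iic v ×ˢ B) ω k) μ :=
    fun v => (memLp_incr hW k u s hA).integrable_mul (memLp_noise hW k v hB)
  have e : ∀ ω, incr W k u s A ω * incr W k u' s' B ω =
      incr W k u s A ω * W (Set.Iic s' ×ˢ B) ω k - incr W k u s A ω * W (Set.Iic u' ×ˢ B) ω k :=
    fun ω => mul_sub _ _ _
  rw [integral_congr_ae (ae_of_all _ e), integral_sub (hi s') (hi u'), h, h, if_pos rfl, if_pos rfl,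
    Set.inter_comm _ (Set.Ioc u' s' ×ˢ B), measureReal_strip_inter hus' hB
      (measurableSet_Ioc.prod hA), Set.inter_comm _ (Set.Ioc u s ×ˢ A),
    Set.inter_comm _ (Set.Ioc u s ×ˢ A)]

lemma integral_incr_sq_le (hW : IsWhiteNoise μ (covMeasure P) W) [IsFiniteMeasure μ] (k : Fin d)
    {u s : ℝ≥0} (hus : u ≤ s) {A : Set (E d)} (hA : MeasurableSet A) :
    ∫ ω, incr W k u s A ω ^ 2 ∂μ ≤ s - u := by
  simp only [pow_two]
  rw [integral_incr_mul_incr hW k hus hus hA hA, Set.inter_self]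
  exact measureReal_strip_le hus hA

/-! ### Independence of the future of the noise from its past -/

/-- The `σ`-field generated by the noise up to time `u`. -/
@[reducible]
def pastSigma (W : Set (ℝ≥0 × E d) → Ω → E d) (u : ℝ≥0) : MeasurableSpace Ω :=
  ⨆ (s : ℝ≥0) (_ : s ≤ u) (A : Set (E d)) (_ : MeasurableSet A),
    MeasurableSpace.comap (W (Set.Iic s ×ˢ A)) inferInstance

/-- The `σ`-field generated by the increments of the noise after time `u`. -/
@[reducible]
def futureSigma (W : Set (ℝ≥0 × E d) → Ω → E d) (u : ℝ≥0) : MeasurableSpace Ω :=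
  MeasurableSpace.comap (fun ω (p : {p : (ℝ≥0 × Set (E d)) × Fin d //
    u ≤ p.1.1 ∧ MeasurableSet p.1.2}) => incr W p.1.2 u p.1.1.1 p.1.1.2 ω) inferInstance

lemma measurable_incr_futureSigma (k : Fin d) {u s : ℝ≥0} (hus : u ≤ s) {A : Set (E d)}
    (hA : MeasurableSet A) : Measurable[futureSigma W u] (incr W k u s A) := by
  have h := comap_measurable (m := inferInstance)
    (fun ω (p : {p : (ℝ≥0 × Set (E d)) × Fin d // u ≤ p.1.1 ∧ MeasurableSet p.1.2}) =>
      incr W p.1.2 u p.1.1.1 p.1.1.2 ω)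
  exact (measurable_pi_apply (⟨((s, A), k), hus, hA⟩ :
    {p : (ℝ≥0 × Set (E d)) × Fin d // u ≤ p.1.1 ∧ MeasurableSet p.1.2})).comp h

/-- The increments after time `u` are uncorrelated with the noise up to time `u`, hence independent
of it, the noise being Gaussian. -/
lemma indep_future_past [IsProbabilityMeasure μ] (hW : IsWhiteNoise μ (covMeasure P) W) (u : ℝ≥0) :
    Indep (futureSigma W u) (pastSigma W u) μ := by
  let S := {p : (ℝ≥0 × Set (E d)) × Fin d // p.1.1 ≤ u ∧ MeasurableSet p.1.2}
  let T := {p : (ℝ≥0 × Set (E d)) × Fin d // u ≤ p.1.1 ∧ MeasurableSet p.1.2}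
  let X : S → Ω → ℝ := fun p ω => W (Set.Iic p.1.1.1 ×ˢ p.1.1.2) ω p.1.2
  let Y : T → Ω → ℝ := fun p ω => incr W p.1.2 u p.1.1.1 p.1.1.2 ω
  have hX : ∀ p, MemLp (X p) 2 μ := fun p => memLp_noise hW _ _ p.2.2
  have hY : ∀ p, MemLp (Y p) 2 μ := fun p => memLp_incr hW _ _ _ p.2.2
  let I := {A : Set (ℝ≥0 × E d) // MeasurableSet A ∧ covMeasure P A < ∞} × Fin d
  let rect : ∀ (s : ℝ≥0) (A : Set (E d)), MeasurableSet A → Fin d → I := fun s A hA k =>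
    ⟨⟨Set.Iic s ×ˢ A, measurableSet_Iic.prod hA, covMeasure_rect_lt_top P s hA⟩, k⟩
  have hgauss : IsGaussianProcess (Sum.elim Y X) μ := by
    classical
    refine hW.gaussian.of_isGaussianProcess ?_
    rintro (p | p)
    · refine ⟨{rect p.1.1.1 p.1.1.2 p.2.2 p.1.2, rect u p.1.1.2 p.2.2 p.1.2},
        ContinuousLinearMap.proj (R := ℝ) (φ := fun _ => ℝ)
          ⟨rect p.1.1.1 p.1.1.2 p.2.2 p.1.2, by simp⟩ -
        ContinuousLinearMap.proj (R := ℝ) (φ := fun _ => ℝ)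
          ⟨rect u p.1.1.2 p.2.2 p.1.2, by simp⟩, fun ω => ?_⟩
      simp [Y, incr, rect]
    · refine ⟨{rect p.1.1.1 p.1.1.2 p.2.2 p.1.2},
        ContinuousLinearMap.proj (R := ℝ) (φ := fun _ => ℝ)
          ⟨rect p.1.1.1 p.1.1.2 p.2.2 p.1.2, by simp⟩, fun ω => ?_⟩
      simp [X, rect]
  have hind : IndepFun (fun ω p => Y p ω) (fun ω p => X p ω) μ := by
    refine hgauss.indepFun_of_covariance_eq_zero
      (fun p => (hY p).aestronglyMeasurable.aemeasurable)
      (fun p => (hX p).aestronglyMeasurable.aemeasurable) fun p q => ?_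
    rw [covariance_eq_sub (hY p) (hX q)]
    have h0 : ∫ ω, Y p ω ∂μ = 0 := integral_incr hW _ _ _ p.2.2
    have h1 : ∫ ω, (Y p * X q) ω ∂μ = 0 := by
      have := integral_incr_mul_noise hW p.1.2 q.1.2 p.2.1 q.1.1.1 p.2.2 q.2.2
      have he : (Set.Ioc u p.1.1.1 ×ˢ p.1.1.2) ∩ (Set.Iic q.1.1.1 ×ˢ q.1.1.2) = ∅ := by
        ext ⟨t, y⟩
        simp only [Set.mem_inter_iff, Set.mem_prod, Set.mem_Ioc, Set.mem_Iic,
          Set.mem_empty_iff_false, iff_false]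
        rintro ⟨⟨⟨h1, -⟩, -⟩, h2, -⟩
        exact absurd (h2.trans q.2.1) (not_le.2 h1)
      rw [he] at this
      simpa [X, Y] using this
    rw [h0, h1, zero_mul, sub_zero]
  refine indep_of_indep_of_le_right (IndepFun_iff_Indep .. |>.1 hind) ?_
  refine iSup_le fun s => iSup_le fun hs => iSup_le fun A => iSup_le fun hA => ?_
  rw [← measurable_iff_comap_le]
  have hXm := comap_measurable (m := inferInstance) (fun ω (p : S) => X p ω)
  have hcoord : Measurable[MeasurableSpace.comap (fun ω (p : S) => X p ω) inferInstance]
      fun ω (k : Fin d) => W (Set.Iic s ×ˢ A) ω k := by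
    refine @measurable_pi_lambda _ _ _ (_) _ _ fun k => ?_
    exact (measurable_pi_apply (⟨((s, A), k), hs, hA⟩ : S)).comp hXm
  exact (WithLp.measurable_toLp 2 _).comp hcoord

lemma pastSigma_le_noiseSigma (u : ℝ≥0) :
    pastSigma W u ≤ noiseSigma (covMeasure P) W := by
  refine iSup_le fun s => iSup_le fun _ => iSup_le fun A => iSup_le fun hA => ?_
  exact le_iSup₂_of_le (Set.Iic s ×ˢ A) ⟨measurableSet_Iic.prod hA,
    covMeasure_rect_lt_top P s hA⟩ le_rfl

lemma measurable_noise_coord {m : MeasurableSpace Ω} {R : Set (ℝ≥0 × E d)}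
    (h : Measurable[m] (W R)) (k : Fin d) : Measurable[m] fun ω => W R ω k :=
  (measurable_pi_apply k).comp ((WithLp.measurable_ofLp 2 _).comp h)

lemma measurable_noiseSigma {R : Set (ℝ≥0 × E d)} {m : Measure (ℝ≥0 × E d)}
    (hR : MeasurableSet R) (hm : m R < ∞) : Measurable[noiseSigma m W] (W R) := by
  rw [measurable_iff_comap_le]
  exact le_iSup₂_of_le R ⟨hR, hm⟩ le_rfl

lemma futureSigma_le_noiseSigma (u : ℝ≥0) :
    futureSigma W u ≤ noiseSigma (covMeasure P) W := by
  rw [← measurable_iff_comap_le]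
  refine @measurable_pi_lambda _ _ _ (_) _ _ fun p => ?_
  have h := fun s => measurable_noise_coord (measurable_noiseSigma (W := W)
    (measurableSet_Iic.prod p.2.2) (covMeasure_rect_lt_top P s p.2.2)) p.1.2
  exact (h p.1.1.1).sub (h u)

lemma noiseSigma_le (hW : IsWhiteNoise μ (covMeasure P) W) :
    noiseSigma (covMeasure P) W ≤ mΩ :=
  iSup₂_le fun A hA => (hW.measurable A hA.1 hA.2).comap_le

end WhiteNoise

section Indep

variable {Ω : Type*} [mΩ : MeasurableSpace Ω] {μ : Measure Ω}

/-- If `b` is independent of `a`, and both together are independent of `c`, then `b` is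
independent of `a` and `c` together. -/
lemma indep_sup_right_of_indep_sup_left [IsProbabilityMeasure μ] {a b c : MeasurableSpace Ω}
    (ha : a ≤ mΩ) (hb : b ≤ mΩ) (hc : c ≤ mΩ) (h1 : Indep b a μ) (h2 : Indep (a ⊔ b) c μ) :
    Indep b (a ⊔ c) μ := by
  let p : Set (Set Ω) := {r | ∃ s t, MeasurableSet[a] s ∧ MeasurableSet[c] t ∧ r = s ∩ t}
  have hp : IsPiSystem p := by
    rintro _ ⟨s, t, hs, ht, rfl⟩ _ ⟨s', t', hs', ht', rfl⟩ -
    exact ⟨s ∩ s', t ∩ t', hs.inter hs', ht.inter ht', Set.inter_inter_inter_comm _ _ _ _⟩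
  have hgen : a ⊔ c = MeasurableSpace.generateFrom p := by
    refine le_antisymm (sup_le ?_ ?_) (MeasurableSpace.generateFrom_le ?_)
    · exact fun s hs => MeasurableSpace.measurableSet_generateFrom
        ⟨s, Set.univ, hs, MeasurableSet.univ, (Set.inter_univ s).symm⟩
    · exact fun t ht => MeasurableSpace.measurableSet_generateFrom
        ⟨Set.univ, t, MeasurableSet.univ, ht, (Set.univ_inter t).symm⟩
    · rintro _ ⟨s, t, hs, ht, rfl⟩
      exact MeasurableSet.inter (le_sup_left (a := a) (b := c) _ hs)
        (le_sup_right (a := a) (b := c) _ ht)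
  refine IndepSets.indep hb (sup_le ha hc) (@MeasurableSpace.isPiSystem_measurableSet Ω b) hp
    (@MeasurableSpace.generateFrom_measurableSet Ω b).symm hgen ?_
  rw [IndepSets_iff]
  rintro r _ hr ⟨s, t, hs, ht, rfl⟩
  rw [Indep_iff] at h1 h2
  have hra : MeasurableSet[a ⊔ b] r := le_sup_right (a := a) (b := b) _ hr
  have hsa : MeasurableSet[a ⊔ b] s := le_sup_left (a := a) (b := b) _ hs
  rw [← Set.inter_assoc, h2 _ _ (hra.inter hsa) ht, h1 _ _ hr hs, h2 _ _ hsa ht, mul_assoc]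

/-- Adding null events to a `σ`-field preserves independence. -/
lemma indep_sup_null {a b : MeasurableSpace Ω} (h : Indep a b μ) :
    Indep a (b ⊔ MeasurableSpace.generateFrom {N : Set Ω | MeasurableSet[mΩ] N ∧ μ N = 0}) μ := by
  rw [Indep_iff] at h ⊢
  intro s t hs ht
  have hle : b ⊔ MeasurableSpace.generateFrom {N : Set Ω | MeasurableSet[mΩ] N ∧ μ N = 0} ≤
      eventuallyMeasurableSpace b (ae μ) := by
    refine sup_le le_eventuallyMeasurableSpace (MeasurableSpace.generateFrom_le ?_)
    rintro N ⟨-, hN⟩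
    exact ⟨∅, MeasurableSpace.measurableSet_empty b, ae_eq_empty.2 hN⟩
  obtain ⟨t', ht', htt'⟩ := hle t ht
  rw [measure_congr htt', measure_congr ((ae_eq_refl s).inter htt'), h s t' hs ht']

end Indep

/-! ### The future of the noises and the filtration -/

section Filtration

variable {d n : ℕ} {Ω : Type*} [mΩ : MeasurableSpace Ω] {μ : Measure Ω} [IsProbabilityMeasure μ]
  {P : Kernel ℝ≥0 (E d)} [IsMarkovKernel P] {W : Fin n → Set (ℝ≥0 × E d) → Ω → E d}
  {hW : ∀ i, IsWhiteNoise μ (covMeasure P) (W i)} {ξ : Fin n → Ω → E d}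
  {hξ : ∀ i, Measurable (ξ i)}

/-- The increments of the `i`-th noise after time `u` are independent of all the noises up to
time `u`, of the initial conditions and of the null events. -/
lemma indep_future_rawSigma (hW : ∀ i, IsWhiteNoise μ (covMeasure P) (W i))
    (hξ : ∀ i, Measurable (ξ i))
    (hind : iIndep (Sum.elim (fun i : Fin n => noiseSigma (covMeasure P) (W i))
      (fun i : Fin n => MeasurableSpace.comap (ξ i) inferInstance)) μ) (i : Fin n) (u : ℝ≥0) :
    Indep (futureSigma (W i) u) (rawSigma μ W ξ u) μ := by
  set m : Fin n ⊕ Fin n → MeasurableSpace Ω := Sum.elim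
    (fun i : Fin n => noiseSigma (covMeasure P) (W i))
    (fun i : Fin n => MeasurableSpace.comap (ξ i) inferInstance) with hm
  have hmle : ∀ j, m j ≤ mΩ := by
    rintro (j | j)
    · exact noiseSigma_le (hW j)
    · exact (hξ j).comap_le
  have hdisj := indep_iSup_of_disjoint hmle hind (S := {Sum.inl i}) (T := {Sum.inl i}ᶜ)
    disjoint_compl_right
  have hpast : pastSigma (W i) u ≤ mΩ := (pastSigma_le_noiseSigma u).trans (noiseSigma_le (hW i))
  have hfut : futureSigma (W i) u ≤ mΩ :=
    (futureSigma_le_noiseSigma u).trans (noiseSigma_le (hW i))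
  have h : Indep (futureSigma (W i) u) (pastSigma (W i) u ⊔
      ⨆ j ∈ ({Sum.inl i}ᶜ : Set (Fin n ⊕ Fin n)), m j) μ := by
    refine indep_sup_right_of_indep_sup_left hpast hfut (iSup₂_le fun j _ => hmle j)
      (indep_future_past (hW i) u) (indep_of_indep_of_le_left hdisj ?_)
    refine le_iSup₂_of_le (Sum.inl i) rfl ?_
    exact sup_le (pastSigma_le_noiseSigma u) (futureSigma_le_noiseSigma u)
  refine indep_of_indep_of_le_right (indep_sup_null h) (sup_le_sup_right (sup_le ?_ ?_) _)
  · refine iSup_le fun j => ?_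
    change pastSigma (W j) u ≤ _
    by_cases hj : j = i
    · subst hj; exact le_sup_left
    · refine le_sup_of_le_right (le_iSup₂_of_le (Sum.inl j) ?_ (pastSigma_le_noiseSigma u))
      simpa using hj
  · refine iSup_le fun j => le_sup_of_le_right ?_
    exact le_iSup₂_of_le (Sum.inr j) (by simp) le_rfl

lemma noiseFiltration_le_rawSigma {a u : ℝ≥0} (hau : a < u) :
    noiseFiltration μ P W hW ξ hξ a ≤ rawSigma μ W ξ u := by
  unfold noiseFiltration
  rw [Filtration.rightCont_eq]
  exact iInf₂_le u hau

lemma rawSigma_le_noiseFiltration (a : ℝ≥0) :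
    rawSigma μ W ξ a ≤ noiseFiltration μ P W hW ξ hξ a := by
  unfold noiseFiltration
  rw [Filtration.rightCont_eq]
  refine le_iInf₂ fun j hj => sup_le_sup_right (sup_le_sup_right ?_ _) _
  exact iSup_mono fun i => iSup_mono fun r => iSup_le fun hr => le_iSup_of_le (hr.trans hj.le) le_rfl

lemma measurable_noise_filtration (i : Fin n) (k : Fin d) {s t : ℝ≥0} (hst : s ≤ t)
    {A : Set (E d)} (hA : MeasurableSet A) :
    Measurable[noiseFiltration μ P W hW ξ hξ t] fun ω => W i (Set.Iic s ×ˢ A) ω k := by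
  refine measurable_noise_coord ?_ k
  rw [measurable_iff_comap_le]
  refine le_trans ?_ (rawSigma_le_noiseFiltration t)
  refine le_sup_of_le_left (le_sup_of_le_left ?_)
  exact le_iSup_of_le i (le_iSup₂_of_le s hst (le_iSup₂_of_le A hA le_rfl))

lemma measurable_incr_filtration (i : Fin n) (k : Fin d) {u s t : ℝ≥0} (hut : u ≤ t) (hst : s ≤ t)
    {A : Set (E d)} (hA : MeasurableSet A) :
    Measurable[noiseFiltration μ P W hW ξ hξ t] (incr (W i) k u s A) :=
  (measurable_noise_filtration i k hst hA).sub (measurable_noise_filtration i k hut hA)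

/-- A variable known at time `a` is independent of the increments after a strictly later time
`u`. Time `a` itself would not do here, because the filtration is made right-continuous. -/
lemma integral_mul_future
    (hind : iIndep (Sum.elim (fun i : Fin n => noiseSigma (covMeasure P) (W i))
      (fun i : Fin n => MeasurableSpace.comap (ξ i) inferInstance)) μ) (i : Fin n) {a u : ℝ≥0}
    (hau : a < u) {Z D : Ω → ℝ} (hZ : Measurable[noiseFiltration μ P W hW ξ hξ a] Z)
    (hD : Measurable[futureSigma (W i) u] D) :
    ∫ ω, Z ω * D ω ∂μ = (∫ ω, Z ω ∂μ) * ∫ ω, D ω ∂μ := by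
  have hI : IndepFun Z D μ := by
    rw [IndepFun_iff_Indep]
    refine (indep_of_indep_of_le (indep_future_rawSigma hW hξ hind i u) ?_ ?_).symm
    · exact measurable_iff_comap_le.1 hD
    · exact (measurable_iff_comap_le.1 hZ).trans (noiseFiltration_le_rawSigma hau)
  refine hI.integral_fun_mul_eq_mul_integral ?_ ?_
  · exact (hZ.mono ((noiseFiltration μ P W hW ξ hξ).le a) le_rfl).aestronglyMeasurable
  · exact (hD.mono ((futureSigma_le_noiseSigma u).trans (noiseSigma_le (hW i)))
      le_rfl).aestronglyMeasurable

lemma eq_zero_of_forall_abs_le {x C : ℝ} {δ : ℝ≥0} (hδ : 0 < δ)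
    (h : ∀ η : ℝ≥0, 0 < η → η ≤ δ → |x| ≤ C * η) : x = 0 := by
  have hlim : Tendsto (fun k : ℕ => C * (δ * (1 / ((k : ℝ) + 1)))) atTop (𝓝 (C * (δ * 0))) :=
    (tendsto_one_div_add_atTop_nhds_zero_nat.const_mul (δ : ℝ)).const_mul C
  rw [mul_zero, mul_zero] at hlim
  have := ge_of_tendsto' hlim fun k : ℕ => by
    have hk : (0 : ℝ≥0) < (k : ℝ≥0) + 1 := by positivity
    have := h (δ * (1 / ((k : ℝ≥0) + 1))) (by positivity)
      (mul_le_of_le_one_right' ((div_le_one hk).2 (by simp)))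
    simpa using this
  exact abs_eq_zero.1 (le_antisymm this (abs_nonneg x))

/-- A short increment is small in `L²`: the correlation of `Z` with the increment over
`(a, a + η²]` is of order `η`. -/
lemma abs_integral_mul_incr_le (hW : ∀ i, IsWhiteNoise μ (covMeasure P) (W i)) (i : Fin n)
    (k : Fin d) (a : ℝ≥0) {η : ℝ≥0} (hη : 0 < η) {A : Set (E d)} (hA : MeasurableSet A)
    {Z : Ω → ℝ} (hZ : MemLp Z 2 μ) :
    |∫ ω, Z ω * incr (W i) k a (a + η ^ 2) A ω ∂μ| ≤ (∫ ω, Z ω ^ 2 ∂μ + 1) * η := by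
  have hη' : (0 : ℝ) < η := hη
  have hD := memLp_incr (hW i) k a (a + η ^ 2) hA
  have h1 := integral_incr_sq_le (hW i) k (le_self_add : a ≤ a + η ^ 2) hA
  have hint : Integrable (fun ω => η * Z ω ^ 2 + (η : ℝ)⁻¹ * incr (W i) k a (a + η ^ 2) A ω ^ 2) μ :=
    (hZ.integrable_sq.const_mul _).add (hD.integrable_sq.const_mul _)
  calc |∫ ω, Z ω * incr (W i) k a (a + η ^ 2) A ω ∂μ|
      ≤ ∫ ω, η * Z ω ^ 2 + (η : ℝ)⁻¹ * incr (W i) k a (a + η ^ 2) A ω ^ 2 ∂μ := by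
        rw [← Real.norm_eq_abs]
        refine norm_integral_le_of_norm_le hint (ae_of_all _ fun ω => ?_)
        set D := incr (W i) k a (a + η ^ 2) A ω
        rw [Real.norm_eq_abs]
        have e : (η : ℝ)⁻¹ * (η * Z ω - D) ^ 2 = η * Z ω ^ 2 - 2 * (Z ω * D) + (η : ℝ)⁻¹ * D ^ 2 := by
          field_simp; ring
        have e' : (η : ℝ)⁻¹ * (η * Z ω + D) ^ 2 =
            η * Z ω ^ 2 + 2 * (Z ω * D) + (η : ℝ)⁻¹ * D ^ 2 := by
          field_simp; ring
        have p : 0 ≤ (η : ℝ)⁻¹ * (η * Z ω - D) ^ 2 := by positivity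
        have p' : 0 ≤ (η : ℝ)⁻¹ * (η * Z ω + D) ^ 2 := by positivity
        have p1 : 0 ≤ (η : ℝ) * Z ω ^ 2 := by positivity
        have p2 : 0 ≤ (η : ℝ)⁻¹ * D ^ 2 := by positivity
        rw [abs_le]
        constructor <;> linarith
    _ = η * ∫ ω, Z ω ^ 2 ∂μ + (η : ℝ)⁻¹ * ∫ ω, incr (W i) k a (a + η ^ 2) A ω ^ 2 ∂μ := by
        rw [integral_add (hZ.integrable_sq.const_mul _) (hD.integrable_sq.const_mul _),
          integral_const_mul, integral_const_mul]
    _ ≤ η * ∫ ω, Z ω ^ 2 ∂μ + (η : ℝ)⁻¹ * (η ^ 2) := by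
        refine add_le_add le_rfl (mul_le_mul_of_nonneg_left (h1.trans_eq ?_) (by positivity))
        push_cast; ring
    _ = (∫ ω, Z ω ^ 2 ∂μ + 1) * η := by field_simp

lemma add_sq_le_of_le_sqrt {a s η : ℝ≥0} (has : a ≤ s) (h : η ≤ NNReal.sqrt (s - a)) :
    a + η ^ 2 ≤ s := by
  rw [NNReal.le_sqrt_iff_sq_le] at h
  calc a + η ^ 2 ≤ a + (s - a) := add_le_add le_rfl h
    _ = s := add_tsub_cancel_of_le has

/-- The increments of the noise after time `a` are orthogonal to the variables known at time `a`.
Right continuity of the filtration is dealt with by waiting until the time `a + η²`. -/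
lemma integral_mul_incr_eq_zero
    (hind : iIndep (Sum.elim (fun i : Fin n => noiseSigma (covMeasure P) (W i))
      (fun i : Fin n => MeasurableSpace.comap (ξ i) inferInstance)) μ) (i : Fin n) (k : Fin d)
    {a s : ℝ≥0} (has : a ≤ s) {A : Set (E d)} (hA : MeasurableSet A) {Z : Ω → ℝ}
    (hZ : Measurable[noiseFiltration μ P W hW ξ hξ a] Z) (hZ2 : MemLp Z 2 μ) :
    ∫ ω, Z ω * incr (W i) k a s A ω ∂μ = 0 := by
  rcases has.eq_or_lt with rfl | has
  · simp [incr_self]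
  set x := ∫ ω, Z ω * incr (W i) k a s A ω ∂μ with hx
  refine eq_zero_of_forall_abs_le (C := ∫ ω, Z ω ^ 2 ∂μ + 1) (δ := NNReal.sqrt (s - a))
    (NNReal.sqrt_pos.2 (tsub_pos_of_lt has)) fun η hη hηs => ?_
  have hlt : a < a + η ^ 2 := lt_add_of_pos_right a (by positivity)
  have hle : a + η ^ 2 ≤ s := add_sq_le_of_le_sqrt has.le hηs
  have h0 : ∫ ω, Z ω * incr (W i) k (a + η ^ 2) s A ω ∂μ = 0 := by
    rw [integral_mul_future hind i hlt hZ (measurable_incr_futureSigma k hle hA),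
      integral_incr (hW i) k _ _ hA, mul_zero]
  have hi : ∀ u v, Integrable (fun ω => Z ω * incr (W i) k u v A ω) μ := fun u v =>
    hZ2.integrable_mul (memLp_incr (hW i) k u v hA)
  have h1 : x = ∫ ω, Z ω * incr (W i) k a (a + η ^ 2) A ω ∂μ := by
    rw [hx, ← add_zero (∫ ω, Z ω * incr (W i) k a (a + η ^ 2) A ω ∂μ), ← h0,
      ← integral_add (hi _ _) (hi _ _)]
    refine integral_congr_ae (ae_of_all _ fun ω => ?_)
    simp only
    rw [incr_add k a (a + η ^ 2) s A ω, mul_add]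
  rw [h1]
  exact abs_integral_mul_incr_le hW i k a hη hA hZ2

lemma memLp_bounded_mul {Z D : Ω → ℝ} (hZ : AEStronglyMeasurable Z μ) {C : ℝ}
    (hC : ∀ ω, |Z ω| ≤ C) (hD : MemLp D 2 μ) : MemLp (fun ω => Z ω * D ω) 2 μ := by
  refine hD.of_le_mul (c := C) (hZ.mul hD.aestronglyMeasurable) (ae_of_all _ fun ω => ?_)
  rw [norm_mul]
  exact mul_le_mul_of_nonneg_right (hC ω) (norm_nonneg _)

/-- Bounded variables known at time `a` are uncorrelated with the product of two increments after
time `a`. As for a single increment, one waits until the time `a + η²`; the error terms are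
correlations with an increment over `(a, a + η²]`. -/
lemma integral_mul_incr_mul_incr
    (hind : iIndep (Sum.elim (fun i : Fin n => noiseSigma (covMeasure P) (W i))
      (fun i : Fin n => MeasurableSpace.comap (ξ i) inferInstance)) μ) (i : Fin n) (k : Fin d)
    {a s s' : ℝ≥0} (has : a ≤ s) (has' : a ≤ s') {A A' : Set (E d)} (hA : MeasurableSet A)
    (hA' : MeasurableSet A') {Z : Ω → ℝ} (hZ : Measurable[noiseFiltration μ P W hW ξ hξ a] Z)
    {C : ℝ} (hC : ∀ ω, |Z ω| ≤ C) :
    ∫ ω, Z ω * (incr (W i) k a s A ω * incr (W i) k a s' A' ω) ∂μ =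
      (∫ ω, Z ω ∂μ) * ∫ ω, incr (W i) k a s A ω * incr (W i) k a s' A' ω ∂μ := by
  rcases has.eq_or_lt with rfl | has
  · simp [incr_self]
  rcases has'.eq_or_lt with rfl | has'
  · simp [incr_self]
  have hZm : AEStronglyMeasurable Z μ :=
    (hZ.mono ((noiseFiltration μ P W hW ξ hξ).le a) le_rfl).aestronglyMeasurable
  have hZi : Integrable Z μ := Integrable.of_bound hZm C (ae_of_all _ hC)
  have hLp : ∀ u v, MemLp (incr (W i) k u v A) 2 μ := fun u v => memLp_incr (hW i) k u v hA
  have hLp' : ∀ u v, MemLp (incr (W i) k u v A') 2 μ := fun u v => memLp_incr (hW i) k u v hA'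
  -- subtract the mean of `Z`
  set Z' : Ω → ℝ := fun ω => Z ω - ∫ ω, Z ω ∂μ with hZ'
  have hZm' : Measurable[noiseFiltration μ P W hW ξ hξ a] Z' := hZ.sub_const _
  have hZa' : AEStronglyMeasurable Z' μ := hZm.sub aestronglyMeasurable_const
  have hZ0 : ∫ ω, Z' ω ∂μ = 0 := by simp [hZ', integral_sub hZi (integrable_const _)]
  set C' := C + |∫ ω, Z ω ∂μ| with hC'
  have hZC : ∀ ω, |Z' ω| ≤ C' := fun ω => (abs_sub _ _).trans (add_le_add (hC ω) le_rfl)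
  have hint : ∀ u v u' v', Integrable
      (fun ω => Z' ω * (incr (W i) k u v A ω * incr (W i) k u' v' A' ω)) μ := fun u v u' v' => by
    have := (memLp_bounded_mul hZa' hZC (hLp u v)).integrable_mul (hLp' u' v')
    refine this.congr (ae_of_all _ fun ω => ?_)
    simp only [Pi.mul_apply]
    ring
  have key : ∫ ω, Z' ω * (incr (W i) k a s A ω * incr (W i) k a s' A' ω) ∂μ = 0 := by
    refine eq_zero_of_forall_abs_le
      (C := (∫ ω, (Z' ω * incr (W i) k a s' A' ω) ^ 2 ∂μ + 1) + (C' ^ 2 * s + 1))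
      (δ := min (NNReal.sqrt (s - a)) (NNReal.sqrt (s' - a)))
      (lt_min (NNReal.sqrt_pos.2 (tsub_pos_of_lt has)) (NNReal.sqrt_pos.2 (tsub_pos_of_lt has')))
      fun η hη hηs => ?_
    have hlt : a < a + η ^ 2 := lt_add_of_pos_right a (by positivity)
    have hle : a + η ^ 2 ≤ s := add_sq_le_of_le_sqrt has.le (hηs.trans (min_le_left _ _))
    have hle' : a + η ^ 2 ≤ s' := add_sq_le_of_le_sqrt has'.le (hηs.trans (min_le_right _ _))
    set u := a + η ^ 2 with hu
    have h0 : ∫ ω, Z' ω * (incr (W i) k u s A ω * incr (W i) k u s' A' ω) ∂μ = 0 := by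
      have hD : Measurable[futureSigma (W i) u]
          fun ω => incr (W i) k u s A ω * incr (W i) k u s' A' ω :=
        (measurable_incr_futureSigma k hle hA).mul (measurable_incr_futureSigma k hle' hA')
      rw [integral_mul_future hind i hlt hZm' hD, hZ0, zero_mul]
    have h1 := abs_integral_mul_incr_le hW i k a hη hA
      (memLp_bounded_mul hZa' hZC (hLp' a s'))
    have h2 := abs_integral_mul_incr_le hW i k a hη hA' (memLp_bounded_mul hZa' hZC (hLp u s))
    rw [← hu] at h1 h2
    have h3 : ∫ ω, (Z' ω * incr (W i) k u s A ω) ^ 2 ∂μ ≤ C' ^ 2 * s := by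
      calc ∫ ω, (Z' ω * incr (W i) k u s A ω) ^ 2 ∂μ
          ≤ ∫ ω, C' ^ 2 * incr (W i) k u s A ω ^ 2 ∂μ := by
            refine integral_mono (memLp_bounded_mul hZa' hZC (hLp u s)).integrable_sq
              ((hLp u s).integrable_sq.const_mul _) fun ω => ?_
            simp only [mul_pow]
            exact mul_le_mul_of_nonneg_right (sq_le_sq.2 ((hZC ω).trans (le_abs_self _)))
              (sq_nonneg _)
        _ ≤ C' ^ 2 * s := by
            rw [integral_const_mul]
            refine mul_le_mul_of_nonneg_left ?_ (sq_nonneg _)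
            have := integral_incr_sq_le (hW i) k hle hA
            have := u.2
            linarith
    have hsplit : ∫ ω, Z' ω * (incr (W i) k a s A ω * incr (W i) k a s' A' ω) ∂μ =
        ∫ ω, (Z' ω * incr (W i) k a s' A' ω) * incr (W i) k a u A ω ∂μ +
          ∫ ω, (Z' ω * incr (W i) k u s A ω) * incr (W i) k a u A' ω ∂μ := by
      have e1 : ∫ ω, (Z' ω * incr (W i) k a s' A' ω) * incr (W i) k a u A ω ∂μ =
          ∫ ω, Z' ω * (incr (W i) k a u A ω * incr (W i) k a s' A' ω) ∂μ :=
        integral_congr_ae (ae_of_all _ fun ω => by simp only; ring)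
      have e2 : ∫ ω, (Z' ω * incr (W i) k u s A ω) * incr (W i) k a u A' ω ∂μ =
          ∫ ω, Z' ω * (incr (W i) k u s A ω * incr (W i) k a u A' ω) ∂μ :=
        integral_congr_ae (ae_of_all _ fun ω => by simp only; ring)
      rw [e1, e2, ← add_zero (_ + _), ← h0, ← integral_add (hint _ _ _ _) (hint _ _ _ _),
        ← integral_add (by exact (hint _ _ _ _).add (hint _ _ _ _)) (hint _ _ _ _)]
      refine integral_congr_ae (ae_of_all _ fun ω => ?_)
      simp only
      rw [incr_add k a u s A ω, incr_add k a u s' A' ω]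
      ring
    rw [hsplit]
    refine (abs_add_le _ _).trans ?_
    rw [add_mul]
    refine add_le_add h1 (h2.trans (mul_le_mul_of_nonneg_right ?_ η.2))
    linarith
  have hII : Integrable (fun ω => incr (W i) k a s A ω * incr (W i) k a s' A' ω) μ :=
    (hLp a s).integrable_mul (hLp' a s')
  have hfin : ∫ ω, Z ω * (incr (W i) k a s A ω * incr (W i) k a s' A' ω) ∂μ =
      ∫ ω, Z' ω * (incr (W i) k a s A ω * incr (W i) k a s' A' ω) ∂μ +
        ∫ ω, (∫ ω, Z ω ∂μ) * (incr (W i) k a s A ω * incr (W i) k a s' A' ω) ∂μ := by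
    rw [← integral_add (hint _ _ _ _) (hII.const_mul _)]
    refine integral_congr_ae (ae_of_all _ fun ω => ?_)
    simp only [hZ']
    ring
  rw [hfin, key, zero_add, integral_const_mul]

/-- The covariance of two elementary stochastic integrals. -/
lemma integral_elementary_mul
    (hind : iIndep (Sum.elim (fun i : Fin n => noiseSigma (covMeasure P) (W i))
      (fun i : Fin n => MeasurableSpace.comap (ξ i) inferInstance)) μ) (i : Fin n) (k : Fin d)
    {a s a' s' : ℝ≥0} (has : a ≤ s) (has' : a' ≤ s') {A A' : Set (E d)} (hA : MeasurableSet A)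
    (hA' : MeasurableSet A') {Z Z' : Ω → ℝ} (hZ : Measurable[noiseFiltration μ P W hW ξ hξ a] Z)
    (hZ' : Measurable[noiseFiltration μ P W hW ξ hξ a'] Z') {C C' : ℝ} (hC : ∀ ω, |Z ω| ≤ C)
    (hC' : ∀ ω, |Z' ω| ≤ C') :
    ∫ ω, (Z ω * incr (W i) k a s A ω) * (Z' ω * incr (W i) k a' s' A' ω) ∂μ =
      (∫ ω, Z ω * Z' ω ∂μ) *
        (covMeasure P).real ((Set.Ioc a s ×ˢ A) ∩ (Set.Ioc a' s' ×ˢ A')) := by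
  wlog haa : a ≤ a' generalizing a s a' s' A A' Z Z' C C'
  · have h := this has' has hA' hA hZ' hZ hC' hC (le_of_not_ge haa)
    rw [Set.inter_comm, integral_congr_ae (ae_of_all _ fun ω => mul_comm _ _), h]
    congr 1
    exact integral_congr_ae (ae_of_all _ fun ω => mul_comm _ _)
  set 𝓕 := noiseFiltration μ P W hW ξ hξ with h𝓕
  have hZa : Measurable[𝓕 a'] Z := hZ.mono (𝓕.mono haa) le_rfl
  have hZZ : Measurable[𝓕 a'] fun ω => Z ω * Z' ω := hZa.mul hZ'
  have hZZm : AEStronglyMeasurable (fun ω => Z ω * Z' ω) μ :=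
    (hZZ.mono (𝓕.le a') le_rfl).aestronglyMeasurable
  have hZZC : ∀ ω, |Z ω * Z' ω| ≤ C * C' := fun ω => by
    rw [abs_mul]
    exact mul_le_mul (hC ω) (hC' ω) (abs_nonneg _) ((abs_nonneg _).trans (hC ω))
  have hLp : ∀ u v, MemLp (incr (W i) k u v A) 2 μ := fun u v => memLp_incr (hW i) k u v hA
  have hLp' : ∀ u v, MemLp (incr (W i) k u v A') 2 μ := fun u v => memLp_incr (hW i) k u v hA'
  -- the part of the first increment before time `a'` does not contribute
  have hpast : ∀ v ≤ a', ∫ ω, (Z ω * Z' ω * incr (W i) k a v A ω) *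
      incr (W i) k a' s' A' ω ∂μ = 0 := fun v hv =>
    integral_mul_incr_eq_zero hind i k has' hA'
      (hZZ.mul (measurable_incr_filtration i k haa hv hA))
      (memLp_bounded_mul hZZm hZZC (hLp a v))
  have hcomm : ∫ ω, (Z ω * incr (W i) k a s A ω) * (Z' ω * incr (W i) k a' s' A' ω) ∂μ =
      ∫ ω, (Z ω * Z' ω * incr (W i) k a s A ω) * incr (W i) k a' s' A' ω ∂μ :=
    integral_congr_ae (ae_of_all _ fun ω => by simp only; ring)
  rw [hcomm]
  rcases le_total s a' with hsa | hsa
  · have hempty : (Set.Ioc a s ×ˢ A) ∩ (Set.Ioc a' s' ×ˢ A') = ∅ := by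
      ext ⟨t, y⟩
      simp only [Set.mem_inter_iff, Set.mem_prod, Set.mem_Ioc, Set.mem_empty_iff_false, iff_false]
      rintro ⟨⟨⟨-, h1⟩, -⟩, ⟨h2, -⟩, -⟩
      exact absurd (h1.trans hsa) (not_le.2 h2)
    rw [hpast s hsa, hempty, measureReal_empty, mul_zero]
  · have hset : (Set.Ioc a s ×ˢ A) ∩ (Set.Ioc a' s' ×ˢ A') =
        (Set.Ioc a' s ×ˢ A) ∩ (Set.Ioc a' s' ×ˢ A') := by
      ext ⟨t, y⟩
      simp only [Set.mem_inter_iff, Set.mem_prod, Set.mem_Ioc]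
      constructor
      · rintro ⟨⟨⟨-, h1⟩, h2⟩, ⟨h3, h4⟩, h5⟩
        exact ⟨⟨⟨h3, h1⟩, h2⟩, ⟨h3, h4⟩, h5⟩
      · rintro ⟨⟨⟨-, h1⟩, h2⟩, ⟨h3, h4⟩, h5⟩
        exact ⟨⟨⟨haa.trans_lt h3, h1⟩, h2⟩, ⟨h3, h4⟩, h5⟩
    have hi : ∀ u v, Integrable (fun ω => (Z ω * Z' ω * incr (W i) k u v A ω) *
        incr (W i) k a' s' A' ω) μ := fun u v =>
      (memLp_bounded_mul hZZm hZZC (hLp u v)).integrable_mul (hLp' a' s')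
    have hfut : ∫ ω, (Z ω * Z' ω * incr (W i) k a' s A ω) * incr (W i) k a' s' A' ω ∂μ =
        (∫ ω, Z ω * Z' ω ∂μ) *
          (covMeasure P).real ((Set.Ioc a' s ×ˢ A) ∩ (Set.Ioc a' s' ×ˢ A')) := by
      rw [← integral_incr_mul_incr (hW i) k hsa has' hA hA',
        ← integral_mul_incr_mul_incr hind i k hsa has' hA hA' hZZ hZZC]
      exact integral_congr_ae (ae_of_all _ fun ω => by simp only; ring)
    rw [hset, ← hfut, ← zero_add (∫ ω, (Z ω * Z' ω * incr (W i) k a' s A ω) *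
      incr (W i) k a' s' A' ω ∂μ), ← hpast a' le_rfl, ← integral_add (hi _ _) (hi _ _)]
    refine integral_congr_ae (ae_of_all _ fun ω => ?_)
    simp only
    rw [incr_add k a a' s A ω]
    ring

end Filtration

/-! ### The isometry for simple integrands -/

section Isometry

variable {d n : ℕ} {Ω : Type*} [mΩ : MeasurableSpace Ω] {μ : Measure Ω}
  {P : Kernel ℝ≥0 (E d)} [IsMarkovKernel P]

instance : SFinite (covMeasure P) := by unfold covMeasure; infer_instance

/-- The support `(t ∧ a_j, t ∧ b_j] × A_j` of the `j`-th term of a simple integrand stopped at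
time `t`. -/
def SimpleIntegrand.box {𝓕 : Filtration ℝ≥0 mΩ} (φ : SimpleIntegrand d 𝓕) (t : ℝ≥0)
    (j : Fin φ.card) : Set (ℝ≥0 × E d) :=
  Set.Ioc (min t (φ.a j)) (min t (φ.b j)) ×ˢ φ.A j

lemma SimpleIntegrand.measurableSet_box {𝓕 : Filtration ℝ≥0 mΩ} (φ : SimpleIntegrand d 𝓕)
    (t : ℝ≥0) (j : Fin φ.card) : MeasurableSet (φ.box t j) :=
  measurableSet_Ioc.prod (φ.measurableSet j)

lemma SimpleIntegrand.eval_eq {𝓕 : Filtration ℝ≥0 mΩ} (φ : SimpleIntegrand d 𝓕)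
    {t s : ℝ≥0} (hs : s ≤ t) (ω : Ω) (y : E d) :
    φ.eval s ω y = ∑ j, φ.ξ j ω * (φ.box t j).indicator 1 (s, y) := by
  refine Finset.sum_congr rfl fun j _ => ?_
  have hiff : (s, y) ∈ Set.Ioc (φ.a j) (φ.b j) ×ˢ φ.A j ↔ (s, y) ∈ φ.box t j := by
    simp only [box, Set.mem_prod, Set.mem_Ioc, le_min_iff, min_lt_iff, not_lt.2 hs,
      false_or, hs, true_and]
  by_cases h : (s, y) ∈ φ.box t j
  · rw [Set.indicator_of_mem (hiff.2 h), Set.indicator_of_mem h, Pi.one_apply, mul_one]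
  · rw [Set.indicator_of_notMem (fun h' => h (hiff.1 h')), Set.indicator_of_notMem h, mul_zero]

lemma SimpleIntegrand.measurable_ξ {𝓕 : Filtration ℝ≥0 mΩ} (φ : SimpleIntegrand d 𝓕)
    (j : Fin φ.card) : Measurable (φ.ξ j) :=
  (φ.measurable j).mono (𝓕.le _) le_rfl

lemma SimpleIntegrand.measurable_eval {𝓕 : Filtration ℝ≥0 mΩ} (φ : SimpleIntegrand d 𝓕) :
    Measurable fun p : Ω × (ℝ≥0 × E d) => φ.eval p.2.1 p.1 p.2.2 := by
  unfold SimpleIntegrand.eval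
  refine Finset.measurable_sum _ fun j _ => ?_
  have : (fun p : Ω × (ℝ≥0 × E d) => (Set.Ioc (φ.a j) (φ.b j) ×ˢ φ.A j).indicator
      (fun _ => φ.ξ j p.1) (p.2.1, p.2.2)) =
      (Prod.snd ⁻¹' (Set.Ioc (φ.a j) (φ.b j) ×ˢ φ.A j)).indicator fun p => φ.ξ j p.1 := by
    ext p; rfl
  rw [this]
  exact ((φ.measurable_ξ j).comp measurable_fst).indicator
    (measurable_snd (measurableSet_Ioc.prod (φ.measurableSet j)))

lemma integrable_bounded_mul_bounded [IsFiniteMeasure μ] {Z Z' : Ω → ℝ} (hZ : Measurable Z)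
    (hZ' : Measurable Z') (hC : ∃ C, ∀ ω, |Z ω| ≤ C) (hC' : ∃ C, ∀ ω, |Z' ω| ≤ C) :
    Integrable (fun ω => Z ω * Z' ω) μ := by
  obtain ⟨C, hC⟩ := hC
  obtain ⟨C', hC'⟩ := hC'
  refine Integrable.of_bound (hZ.mul hZ').aestronglyMeasurable (C * C') (ae_of_all _ fun ω => ?_)
  rw [norm_mul]
  exact mul_le_mul (hC ω) (hC' ω) (norm_nonneg _) ((abs_nonneg _).trans (hC ω))

lemma enorm_sq_eq_ofReal (x : ℝ) : ‖x‖ₑ ^ 2 = ENNReal.ofReal (x ^ 2) := by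
  rw [Real.enorm_eq_ofReal_abs, ← ENNReal.ofReal_pow (abs_nonneg x), sq_abs]

/-- The squared `L²` norm of a simple integrand, for fixed `ω`. -/
lemma SimpleIntegrand.lintegral_eval_sq {𝓕 : Filtration ℝ≥0 mΩ} (φ : SimpleIntegrand d 𝓕)
    (t : ℝ≥0) (ω : Ω) :
    0 ≤ ∑ j, ∑ l, φ.ξ j ω * φ.ξ l ω * (covMeasure P).real (φ.box t j ∩ φ.box t l) ∧
    ∫⁻ q in Set.Iic t ×ˢ Set.univ, ‖φ.eval q.1 ω q.2‖ₑ ^ 2 ∂(covMeasure P) =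
      ENNReal.ofReal (∑ j, ∑ l, φ.ξ j ω * φ.ξ l ω *
        (covMeasure P).real (φ.box t j ∩ φ.box t l)) := by
  set S : Set (ℝ≥0 × E d) := Set.Iic t ×ˢ Set.univ with hS
  have hSm : MeasurableSet S := measurableSet_Iic.prod MeasurableSet.univ
  have hfin : IsFiniteMeasure ((covMeasure P).restrict S) :=
    ⟨by rw [Measure.restrict_apply_univ]; exact covMeasure_rect_lt_top P t MeasurableSet.univ⟩
  have hbS : ∀ j, φ.box t j ⊆ S := fun j q hq =>
    ⟨hq.1.2.trans (min_le_left _ _), Set.mem_univ _⟩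
  have hbm : ∀ j l, MeasurableSet (φ.box t j ∩ φ.box t l) := fun j l =>
    (φ.measurableSet_box t j).inter (φ.measurableSet_box t l)
  let g : ℝ≥0 × E d → ℝ := fun q => ∑ j, ∑ l, φ.ξ j ω * φ.ξ l ω *
    (φ.box t j ∩ φ.box t l).indicator 1 q
  have hsq : ∀ q, q ∈ S → φ.eval q.1 ω q.2 ^ 2 = g q := by
    intro q hq
    rw [φ.eval_eq hq.1, pow_two, Finset.sum_mul_sum]
    refine Finset.sum_congr rfl fun j _ => Finset.sum_congr rfl fun l _ => ?_
    rw [Set.inter_indicator_one, Pi.mul_apply]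
    ring
  have hterm : ∀ j l, Integrable (fun q => φ.ξ j ω * φ.ξ l ω *
      (φ.box t j ∩ φ.box t l).indicator (1 : ℝ≥0 × E d → ℝ) q) ((covMeasure P).restrict S) :=
    fun j l => ((integrable_const (1 : ℝ)).indicator (hbm j l)).const_mul _
  have hg : Integrable g ((covMeasure P).restrict S) :=
    integrable_finsetSum _ fun j _ => integrable_finsetSum _ fun l _ => hterm j l
  have hint : ∫ q in S, g q ∂(covMeasure P) = ∑ j, ∑ l, φ.ξ j ω * φ.ξ l ω *
      (covMeasure P).real (φ.box t j ∩ φ.box t l) := by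
    simp only [g]
    rw [integral_finsetSum _ fun j _ => integrable_finsetSum _ fun l _ => hterm j l]
    refine Finset.sum_congr rfl fun j _ => ?_
    rw [integral_finsetSum _ fun l _ => hterm j l]
    refine Finset.sum_congr rfl fun l _ => ?_
    rw [integral_const_mul, integral_indicator_one (hbm j l), measureReal_restrict_apply (hbm j l),
      Set.inter_eq_self_of_subset_left (Set.inter_subset_left.trans (hbS j))]
  have hnn : 0 ≤ᵐ[(covMeasure P).restrict S] g := by
    filter_upwards [ae_restrict_mem hSm] with q hq
    rw [← hsq q hq]
    exact sq_nonneg _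
  rw [← hint]
  refine ⟨integral_nonneg_of_ae hnn, ?_⟩
  rw [ofReal_integral_eq_lintegral_ofReal hg hnn]
  refine setLIntegral_congr_fun hSm fun q hq => ?_
  rw [enorm_sq_eq_ofReal, hsq q hq]

variable [IsProbabilityMeasure μ] {W : Fin n → Set (ℝ≥0 × E d) → Ω → E d}
  {hW : ∀ i, IsWhiteNoise μ (covMeasure P) (W i)} {ξ : Fin n → Ω → E d}
  {hξ : ∀ i, Measurable (ξ i)}

lemma SimpleIntegrand.integral_eq {𝓕 : Filtration ℝ≥0 mΩ} (φ : SimpleIntegrand d 𝓕) (t : ℝ≥0)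
    (i : Fin n) (k : Fin d) (ω : Ω) :
    φ.integral (fun A ω => W i A ω k) t ω =
      ∑ j, φ.ξ j ω * incr (W i) k (min t (φ.a j)) (min t (φ.b j)) (φ.A j) ω := rfl

lemma SimpleIntegrand.memLp_term {𝓕 : Filtration ℝ≥0 mΩ} (φ : SimpleIntegrand d 𝓕)
    (hW : ∀ i, IsWhiteNoise μ (covMeasure P) (W i)) (t : ℝ≥0)
    (i : Fin n) (k : Fin d) (j : Fin φ.card) :
    MemLp (fun ω => φ.ξ j ω * incr (W i) k (min t (φ.a j)) (min t (φ.b j)) (φ.A j) ω) 2 μ := by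
  obtain ⟨C, hC⟩ := φ.bounded j
  exact memLp_bounded_mul (φ.measurable_ξ j).aestronglyMeasurable hC
    (memLp_incr (hW i) k _ _ (φ.measurableSet j))

lemma SimpleIntegrand.memLp_integral {𝓕 : Filtration ℝ≥0 mΩ} (φ : SimpleIntegrand d 𝓕)
    (hW : ∀ i, IsWhiteNoise μ (covMeasure P) (W i)) (t : ℝ≥0) (i : Fin n) (k : Fin d) :
    MemLp (φ.integral (fun A ω => W i A ω k) t) 2 μ :=
  memLp_finsetSum _ fun j _ => φ.memLp_term hW t i k j

/-- The isometry for stochastic integrals of simple integrands with respect to the noise. -/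
lemma SimpleIntegrand.lintegral_integral_sq
    (hind : iIndep (Sum.elim (fun i : Fin n => noiseSigma (covMeasure P) (W i))
      (fun i : Fin n => MeasurableSpace.comap (ξ i) inferInstance)) μ)
    (φ : SimpleIntegrand d (noiseFiltration μ P W hW ξ hξ)) (t : ℝ≥0) (i : Fin n) (k : Fin d) :
    ∫⁻ ω, ‖φ.integral (fun A ω => W i A ω k) t ω‖ₑ ^ 2 ∂μ =
      ∫⁻ ω, ∫⁻ q in Set.Iic t ×ˢ Set.univ, ‖φ.eval q.1 ω q.2‖ₑ ^ 2 ∂(covMeasure P) ∂μ := by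
  let D : Fin φ.card → Ω → ℝ := fun j =>
    incr (W i) k (min t (φ.a j)) (min t (φ.b j)) (φ.A j)
  have hD : ∀ j, MemLp (fun ω => φ.ξ j ω * D j ω) 2 μ := fun j => φ.memLp_term hW t i k j
  have hDD : ∀ j l, Integrable (fun ω => (φ.ξ j ω * D j ω) * (φ.ξ l ω * D l ω)) μ := fun j l =>
    (hD j).integrable_mul (hD l)
  have hξξ : ∀ j l, Integrable (fun ω => φ.ξ j ω * φ.ξ l ω) μ := fun j l =>
    integrable_bounded_mul_bounded (φ.measurable_ξ j) (φ.measurable_ξ l) (φ.bounded j) (φ.bounded l)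
  have hpair : ∀ j l, ∫ ω, (φ.ξ j ω * D j ω) * (φ.ξ l ω * D l ω) ∂μ =
      (∫ ω, φ.ξ j ω * φ.ξ l ω ∂μ) * (covMeasure P).real (φ.box t j ∩ φ.box t l) := by
    -- a term that starts after time `t` vanishes
    have hlate : ∀ j, t < φ.a j → (∀ ω, D j ω = 0) ∧ φ.box t j = ∅ := by
      intro j hj
      have h1 : min t (φ.a j) = t := min_eq_left hj.le
      have h2 : min t (φ.b j) = t := min_eq_left (hj.le.trans (φ.le j))
      exact ⟨fun ω => by simp only [D, h1, h2, incr_self], by simp [box, h1, h2]⟩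
    intro j l
    rcases lt_or_ge t (φ.a j) with hj | hj
    · simp [(hlate j hj).1, (hlate j hj).2]
    rcases lt_or_ge t (φ.a l) with hl | hl
    · simp [(hlate l hl).1, (hlate l hl).2]
    obtain ⟨C, hC⟩ := φ.bounded j
    obtain ⟨C', hC'⟩ := φ.bounded l
    simp only [D, box, min_eq_right hj, min_eq_right hl]
    exact integral_elementary_mul hind i k (le_min hj (φ.le j)) (le_min hl (φ.le l))
      (φ.measurableSet j) (φ.measurableSet l) (φ.measurable j) (φ.measurable l) hC hC'
  have hsq : ∀ ω, φ.integral (fun A ω => W i A ω k) t ω ^ 2 =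
      ∑ j, ∑ l, (φ.ξ j ω * D j ω) * (φ.ξ l ω * D l ω) := fun ω => by
    rw [φ.integral_eq, pow_two, Finset.sum_mul_sum]
  have hleft : ∫ ω, φ.integral (fun A ω => W i A ω k) t ω ^ 2 ∂μ =
      ∫ ω, ∑ j, ∑ l, φ.ξ j ω * φ.ξ l ω *
        (covMeasure P).real (φ.box t j ∩ φ.box t l) ∂μ := by
    simp only [hsq]
    rw [integral_finsetSum _ fun j _ => integrable_finsetSum _ fun l _ => hDD j l,
      integral_finsetSum _ fun j _ => integrable_finsetSum _ fun l _ => (hξξ j l).mul_const _]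
    refine Finset.sum_congr rfl fun j _ => ?_
    rw [integral_finsetSum _ fun l _ => hDD j l,
      integral_finsetSum _ fun l _ => (hξξ j l).mul_const _]
    exact Finset.sum_congr rfl fun l _ => by rw [hpair, integral_mul_const]
  rw [lintegral_congr fun ω => (φ.lintegral_eval_sq t ω).2]
  simp only [enorm_sq_eq_ofReal]
  rw [← ofReal_integral_eq_lintegral_ofReal (φ.memLp_integral hW t i k).integrable_sq
      (ae_of_all _ fun ω => sq_nonneg _), hleft,
    ofReal_integral_eq_lintegral_ofReal (integrable_finsetSum _ fun j _ =>
      integrable_finsetSum _ fun l _ => (hξξ j l).mul_const _)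
      (ae_of_all _ fun ω => (φ.lintegral_eval_sq t ω).1)]

/-! ### Square integrability of Walsh integrals -/

lemma ennreal_add_sq_le (x y : ℝ≥0∞) : (x + y) ^ 2 ≤ 2 * x ^ 2 + 2 * y ^ 2 := by
  rcases eq_or_ne x ∞ with rfl | hx
  · simp
  rcases eq_or_ne y ∞ with rfl | hy
  · simp
  lift x to ℝ≥0 using hx
  lift y to ℝ≥0 using hy
  norm_cast
  rw [← NNReal.coe_le_coe]
  push_cast
  nlinarith [sq_nonneg ((x : ℝ) - y)]

lemma enorm_sq_le {V : Type*} [SeminormedAddCommGroup V] (a b : V) :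
    ‖a‖ₑ ^ 2 ≤ 2 * ‖b - a‖ₑ ^ 2 + 2 * ‖b‖ₑ ^ 2 := by
  refine le_trans (pow_le_pow_left' ?_ 2) (ennreal_add_sq_le _ _)
  calc ‖a‖ₑ = ‖b - (b - a)‖ₑ := by rw [sub_sub_cancel]
    _ ≤ ‖b‖ₑ + ‖b - a‖ₑ := enorm_sub_le
    _ = ‖b - a‖ₑ + ‖b‖ₑ := add_comm _ _

/-- The square of the norm of `f` in `L²(P(dω) ⊗ 1_{s ≤ t} m(ds, dy))`. -/
def fieldNormSq (μ : Measure Ω) (m : Measure (ℝ≥0 × E d)) (t : ℝ≥0) (f : ℝ≥0 → Ω → E d → ℝ) :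
    ℝ≥0∞ :=
  ∫⁻ ω, ∫⁻ q in Set.Iic t ×ˢ Set.univ, ‖f q.1 ω q.2‖ₑ ^ 2 ∂m ∂μ

lemma fieldNormSq_mono (μ : Measure Ω) (m : Measure (ℝ≥0 × E d)) {s t : ℝ≥0} (hst : s ≤ t)
    (f : ℝ≥0 → Ω → E d → ℝ) : fieldNormSq μ m s f ≤ fieldNormSq μ m t f :=
  lintegral_mono fun _ =>
    lintegral_mono_set (Set.prod_mono (Set.Iic_subset_Iic.2 hst) le_rfl)

lemma fieldNormSq_le (μ : Measure Ω) (m : Measure (ℝ≥0 × E d)) [SFinite m] (t : ℝ≥0)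
    {f g : ℝ≥0 → Ω → E d → ℝ} (hg : Measurable fun p : Ω × (ℝ≥0 × E d) => g p.2.1 p.1 p.2.2) :
    fieldNormSq μ m t f ≤
      2 * fieldNormSq μ m t (fun s ω y => g s ω y - f s ω y) + 2 * fieldNormSq μ m t g := by
  have hg2 : Measurable fun p : Ω × (ℝ≥0 × E d) => ‖g p.2.1 p.1 p.2.2‖ₑ ^ 2 :=
    hg.enorm.pow_const 2
  have hgω : ∀ ω, Measurable fun q : ℝ≥0 × E d => ‖g q.1 ω q.2‖ₑ ^ 2 := fun ω =>
    hg2.comp measurable_prodMk_left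
  have hout : Measurable fun ω =>
      ∫⁻ q in Set.Iic t ×ˢ Set.univ, ‖g q.1 ω q.2‖ₑ ^ 2 ∂m := hg2.lintegral_prod_right'
  unfold fieldNormSq
  rw [← lintegral_const_mul' 2 _ ENNReal.ofNat_ne_top, ← lintegral_const_mul _ hout,
    ← lintegral_add_right _ (hout.const_mul 2)]
  refine lintegral_mono fun ω => ?_
  rw [← lintegral_const_mul' 2 _ ENNReal.ofNat_ne_top, ← lintegral_const_mul _ (hgω ω),
    ← lintegral_add_right _ ((hgω ω).const_mul 2)]
  exact lintegral_mono fun q => enorm_sq_le _ _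

lemma fieldNormSq_simple_lt_top
    (hind : iIndep (Sum.elim (fun i : Fin n => noiseSigma (covMeasure P) (W i))
      (fun i : Fin n => MeasurableSpace.comap (ξ i) inferInstance)) μ)
    (φ : SimpleIntegrand d (noiseFiltration μ P W hW ξ hξ)) (t : ℝ≥0) (i : Fin n) (k : Fin d) :
    fieldNormSq μ (covMeasure P) t φ.eval < ∞ := by
  have h := φ.lintegral_integral_sq hind t i k
  have h2 := (φ.memLp_integral hW t i k).integrable_sq.2
  rw [hasFiniteIntegral_iff_enorm] at h2
  unfold fieldNormSq
  rw [← h]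
  simpa only [enorm_pow] using h2

/-- An integrand with a Walsh integral is square integrable. -/
lemma IsWalshIntegral.fieldNormSq_lt_top
    (hind : iIndep (Sum.elim (fun i : Fin n => noiseSigma (covMeasure P) (W i))
      (fun i : Fin n => MeasurableSpace.comap (ξ i) inferInstance)) μ) {i : Fin n} {k : Fin d}
    {f : ℝ≥0 → Ω → E d → ℝ} {t : ℝ≥0} {I : Ω → ℝ}
    (hI : IsWalshIntegral μ (noiseFiltration μ P W hW ξ hξ) (covMeasure P)
      (fun A ω => W i A ω k) f t I) :
    fieldNormSq μ (covMeasure P) t f < ∞ := by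
  obtain ⟨-, φ, hφ, -⟩ := hI
  obtain ⟨r, hr⟩ := (hφ.eventually_lt_const ENNReal.zero_lt_top).exists
  refine (fieldNormSq_le μ (covMeasure P) t (φ r).measurable_eval).trans_lt ?_
  exact ENNReal.add_lt_top.2 ⟨ENNReal.mul_lt_top ENNReal.ofNat_lt_top hr,
    ENNReal.mul_lt_top ENNReal.ofNat_lt_top (fieldNormSq_simple_lt_top hind (φ r) t i k)⟩

/-- The second moment of a Walsh integral is controlled by the norm of the integrand. -/
lemma IsWalshIntegral.lintegral_sq_le
    (hind : iIndep (Sum.elim (fun i : Fin n => noiseSigma (covMeasure P) (W i))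
      (fun i : Fin n => MeasurableSpace.comap (ξ i) inferInstance)) μ) {i : Fin n} {k : Fin d}
    {f : ℝ≥0 → Ω → E d → ℝ} {t : ℝ≥0} {I : Ω → ℝ}
    (hf : Measurable fun p : Ω × (ℝ≥0 × E d) => f p.2.1 p.1 p.2.2)
    (hI : IsWalshIntegral μ (noiseFiltration μ P W hW ξ hξ) (covMeasure P)
      (fun A ω => W i A ω k) f t I) :
    ∫⁻ ω, ‖I ω‖ₑ ^ 2 ∂μ ≤ 6 + 4 * fieldNormSq μ (covMeasure P) t f := by
  obtain ⟨hIm, φ, hφ, hφI⟩ := hI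
  obtain ⟨r, hr, hrI⟩ := ((hφ.eventually_lt_const zero_lt_one).and
    (hφI.eventually_lt_const zero_lt_one)).exists
  have hJ : AEMeasurable ((φ r).integral (fun A ω => W i A ω k) t) μ :=
    ((φ r).memLp_integral hW t i k).aestronglyMeasurable.aemeasurable
  have h1 : ∫⁻ ω, ‖I ω‖ₑ ^ 2 ∂μ ≤
      2 * ∫⁻ ω, ‖(φ r).integral (fun A ω => W i A ω k) t ω - I ω‖ₑ ^ 2 ∂μ +
        2 * ∫⁻ ω, ‖(φ r).integral (fun A ω => W i A ω k) t ω‖ₑ ^ 2 ∂μ := by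
    rw [← lintegral_const_mul' 2 _ ENNReal.ofNat_ne_top,
      ← lintegral_const_mul' 2 _ ENNReal.ofNat_ne_top,
      ← lintegral_add_right' _ ((hJ.enorm.pow_const 2).const_mul 2)]
    exact lintegral_mono fun ω => enorm_sq_le _ _
  have h2 := fieldNormSq_le μ (covMeasure P) t (f := (φ r).eval) hf
  have h3 : fieldNormSq μ (covMeasure P) t (fun s ω y => f s ω y - (φ r).eval s ω y) ≤ 1 := by
    refine le_trans (le_of_eq ?_) hr.le
    exact lintegral_congr fun ω => lintegral_congr fun q => by rw [enorm_sub_rev]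
  rw [(φ r).lintegral_integral_sq hind t i k] at h1
  change _ ≤ _ + 2 * fieldNormSq μ (covMeasure P) t (φ r).eval at h1
  calc ∫⁻ ω, ‖I ω‖ₑ ^ 2 ∂μ
      ≤ 2 * 1 + 2 * (2 * 1 + 2 * fieldNormSq μ (covMeasure P) t f) := by
        refine h1.trans (add_le_add (mul_le_mul_right hrI.le _) (mul_le_mul_right (h2.trans ?_) _))
        exact add_le_add (mul_le_mul_right h3 _) le_rfl
    _ = 6 + 4 * fieldNormSq μ (covMeasure P) t f := by ring

end Isometry

/-! ### An integral inequality of Gronwall type -/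

lemma lintegral_exp_tail {c : ℝ} (hc : 0 < c) (s : ℝ≥0) :
    ∫⁻ t in Set.Ici s, ENNReal.ofReal (Real.exp (-c * t)) ∂timeMeasure =
      ENNReal.ofReal (Real.exp (-c * s)) * ENNReal.ofReal (1 / c) := by
  unfold timeMeasure
  rw [setLIntegral_map measurableSet_Ici (by fun_prop) measurable_real_toNNReal,
    Measure.restrict_restrict (measurable_real_toNNReal measurableSet_Ici)]
  have hset : Real.toNNReal ⁻¹' Set.Ici s ∩ Set.Ici (0 : ℝ) = Set.Ici (s : ℝ) := by
    ext x
    simp only [Set.mem_inter_iff, Set.mem_preimage, Set.mem_Ici]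
    constructor
    · rintro ⟨h1, h2⟩
      rw [← Real.coe_toNNReal x h2]
      exact_mod_cast h1
    · intro h
      have h0 : 0 ≤ x := s.2.trans h
      refine ⟨?_, h0⟩
      rw [← NNReal.coe_le_coe, Real.coe_toNNReal x h0]
      exact h
  rw [hset]
  calc ∫⁻ x in Set.Ici (s : ℝ), ENNReal.ofReal (Real.exp (-c * (Real.toNNReal x : ℝ)))
      = ∫⁻ x in Set.Ici (s : ℝ), ENNReal.ofReal (Real.exp (-c * x)) :=
        setLIntegral_congr_fun measurableSet_Ici fun x hx => by
          rw [Real.coe_toNNReal x (s.2.trans hx)]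
    _ = ∫⁻ x in Set.Ioi (s : ℝ), ENNReal.ofReal (Real.exp (-c * x)) :=
        setLIntegral_congr Ioi_ae_eq_Ici.symm
    _ = ENNReal.ofReal (∫ x in Set.Ioi (s : ℝ), Real.exp (-c * x)) :=
        (ofReal_integral_eq_lintegral_ofReal (integrableOn_exp_mul_Ioi (neg_lt_zero.2 hc) s)
          (ae_of_all _ fun x => (Real.exp_pos _).le)).symm
    _ = ENNReal.ofReal (Real.exp (-c * s)) * ENNReal.ofReal (1 / c) := by
        rw [integral_exp_mul_Ioi (neg_lt_zero.2 hc), ← ENNReal.ofReal_mul (Real.exp_pos _).le]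
        congr 1
        field_simp

instance isFiniteMeasure_restrict_Iic (T : ℝ≥0) :
    IsFiniteMeasure (timeMeasure.restrict (Set.Iic T)) :=
  ⟨by simp [timeMeasure_Iic]⟩

/-- An integral version of Gronwall's lemma. The exponential weight makes the Volterra operator on
the right-hand side a contraction of factor `1/2`, so that it can be absorbed. -/
lemma lintegral_exp_mul_le_of_le_add_lintegral {g A : ℝ≥0 → ℝ≥0∞} (hg : Measurable g)
    (hA : Measurable A) {κ T : ℝ≥0} (hfin : ∫⁻ t in Set.Iic T, g t ∂timeMeasure < ∞)
    (h : ∀ t ≤ T, g t ≤ A t + κ * ∫⁻ s in Set.Iic t, g s ∂timeMeasure) :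
    ∫⁻ t in Set.Iic T, ENNReal.ofReal (Real.exp (-(2 * κ + 1) * t)) * g t ∂timeMeasure ≤
      2 * ∫⁻ t in Set.Iic T, A t ∂timeMeasure := by
  set c : ℝ := 2 * κ + 1 with hc
  have hκ : (0 : ℝ) ≤ κ := κ.2
  have hc0 : 0 < c := by positivity
  set e : ℝ≥0 → ℝ≥0∞ := fun t => ENNReal.ofReal (Real.exp (-c * t)) with he
  have hem : Measurable e := by simp only [he]; fun_prop
  have he1 : ∀ t, e t ≤ 1 := fun t => by
    refine ENNReal.ofReal_le_one.2 (Real.exp_le_one_iff.2 ?_)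
    rw [neg_mul]
    exact neg_nonpos.2 (mul_nonneg hc0.le t.coe_nonneg)
  set G := ∫⁻ t in Set.Iic T, e t * g t ∂timeMeasure with hG
  have hGfin : G ≠ ∞ :=
    ((lintegral_mono fun t => mul_le_of_le_one_left' (he1 t)).trans_lt hfin).ne
  let F : ℝ≥0 → ℝ≥0 → ℝ≥0∞ := fun t s => (Set.Iic t).indicator (fun s => e t * g s) s
  have hFm : Measurable (Function.uncurry F) := by
    have : Function.uncurry F =
        {p : ℝ≥0 × ℝ≥0 | p.2 ≤ p.1}.indicator fun p => e p.1 * g p.2 := by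
      ext ⟨t, s⟩
      simp [F, Function.uncurry, Set.indicator_apply]
    rw [this]
    exact ((hem.comp measurable_fst).mul (hg.comp measurable_snd)).indicator
      (measurableSet_le measurable_snd measurable_fst)
  have hdouble : ∫⁻ t in Set.Iic T, e t * ∫⁻ s in Set.Iic t, g s ∂timeMeasure ∂timeMeasure ≤
      G * ENNReal.ofReal (1 / c) := by
    calc ∫⁻ t in Set.Iic T, e t * ∫⁻ s in Set.Iic t, g s ∂timeMeasure ∂timeMeasure
        = ∫⁻ t in Set.Iic T, ∫⁻ s in Set.Iic T, F t s ∂timeMeasure ∂timeMeasure := by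
          refine setLIntegral_congr_fun measurableSet_Iic fun t ht => ?_
          simp only [F]
          rw [setLIntegral_indicator measurableSet_Iic, lintegral_const_mul _ hg,
            Set.inter_eq_self_of_subset_left (Set.Iic_subset_Iic.2 ht)]
      _ = ∫⁻ s in Set.Iic T, ∫⁻ t in Set.Iic T, F t s ∂timeMeasure ∂timeMeasure :=
          lintegral_lintegral_swap hFm.aemeasurable
      _ ≤ ∫⁻ s in Set.Iic T, e s * g s * ENNReal.ofReal (1 / c) ∂timeMeasure := by
          refine lintegral_mono fun s => ?_
          calc ∫⁻ t in Set.Iic T, F t s ∂timeMeasure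
              ≤ ∫⁻ t, F t s ∂timeMeasure := setLIntegral_le_lintegral _ _
            _ = ∫⁻ t, (Set.Ici s).indicator (fun t => e t * g s) t ∂timeMeasure := by
                refine lintegral_congr fun t => ?_
                simp [F, Set.indicator_apply]
            _ = (∫⁻ t in Set.Ici s, e t ∂timeMeasure) * g s := by
                rw [lintegral_indicator measurableSet_Ici, lintegral_mul_const _ hem]
            _ ≤ e s * ENNReal.ofReal (1 / c) * g s :=
                mul_le_mul_left (lintegral_exp_tail hc0 s).le _
            _ = e s * g s * ENNReal.ofReal (1 / c) := by ring
      _ = G * ENNReal.ofReal (1 / c) := lintegral_mul_const _ (hem.mul hg)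
  have hhalf : (κ : ℝ≥0∞) * ENNReal.ofReal (1 / c) ≤ 2⁻¹ := by
    rw [← ENNReal.ofReal_coe_nnreal, ← ENNReal.ofReal_mul hκ,
      show (2⁻¹ : ℝ≥0∞) = ENNReal.ofReal 2⁻¹ by
        rw [ENNReal.ofReal_inv_of_pos two_pos, ENNReal.ofReal_ofNat]]
    refine ENNReal.ofReal_le_ofReal ?_
    rw [mul_one_div, div_le_iff₀ hc0, hc]
    linarith
  have hmain : G ≤ ∫⁻ t in Set.Iic T, A t ∂timeMeasure + 2⁻¹ * G := by
    calc G ≤ ∫⁻ t in Set.Iic T, (A t + κ * (e t * ∫⁻ s in Set.Iic t, g s ∂timeMeasure))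
            ∂timeMeasure := by
          refine setLIntegral_mono' measurableSet_Iic fun t ht => ?_
          calc e t * g t ≤ e t * (A t + κ * ∫⁻ s in Set.Iic t, g s ∂timeMeasure) :=
                mul_le_mul_right (h t ht) _
            _ = e t * A t + κ * (e t * ∫⁻ s in Set.Iic t, g s ∂timeMeasure) := by ring
            _ ≤ _ := add_le_add (mul_le_of_le_one_left' (he1 t)) le_rfl
      _ = ∫⁻ t in Set.Iic T, A t ∂timeMeasure +
            κ * ∫⁻ t in Set.Iic T, e t * ∫⁻ s in Set.Iic t, g s ∂timeMeasure ∂timeMeasure := by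
          rw [lintegral_add_left hA, lintegral_const_mul' _ _ ENNReal.coe_ne_top]
      _ ≤ ∫⁻ t in Set.Iic T, A t ∂timeMeasure + κ * (G * ENNReal.ofReal (1 / c)) :=
          add_le_add le_rfl (mul_le_mul_right hdouble _)
      _ = ∫⁻ t in Set.Iic T, A t ∂timeMeasure + κ * ENNReal.ofReal (1 / c) * G := by ring
      _ ≤ _ := add_le_add le_rfl (mul_le_mul_left hhalf _)
  have hhG : 2⁻¹ * G ≠ ∞ := ENNReal.mul_ne_top (by simp) hGfin
  have hsplit : G = 2⁻¹ * G + 2⁻¹ * G := by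
    rw [← add_mul, ENNReal.inv_two_add_inv_two, one_mul]
  have h1 : 2⁻¹ * G ≤ ∫⁻ t in Set.Iic T, A t ∂timeMeasure := by
    refine ENNReal.le_of_add_le_add_right hhG ?_
    rw [← hsplit]
    exact hmain
  calc G = 2 * (2⁻¹ * G) := by
        rw [← mul_assoc, ENNReal.mul_inv_cancel two_ne_zero ENNReal.ofNat_ne_top, one_mul]
    _ ≤ _ := mul_le_mul_right h1 _

/-- The Cauchy-Schwarz inequality for the integral over `[0, t]`. -/
lemma sq_lintegral_Iic_le {f : ℝ≥0 → ℝ≥0∞} (hf : Measurable f) (t : ℝ≥0) :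
    (∫⁻ s in Set.Iic t, f s ∂timeMeasure) ^ 2 ≤ t * ∫⁻ s in Set.Iic t, f s ^ 2 ∂timeMeasure := by
  have h := ENNReal.lintegral_mul_le_Lp_mul_Lq (timeMeasure.restrict (Set.Iic t))
    Real.HolderConjugate.two_two hf.aemeasurable (g := fun _ => 1) aemeasurable_const
  have hsq : ∀ x : ℝ≥0∞, (x ^ (1 / 2 : ℝ)) ^ 2 = x := fun x => by
    rw [← ENNReal.rpow_natCast, ← ENNReal.rpow_mul]; norm_num
  have h2 := pow_le_pow_left' h 2
  simp only [Pi.mul_apply, mul_one, mul_pow, hsq, ENNReal.rpow_two, one_pow, lintegral_const,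
    Measure.restrict_apply_univ, timeMeasure_Iic, one_mul] at h2
  rwa [mul_comm] at h2

lemma sum_sq_le_two_pow_mul {ι : Type*} (s : Finset ι) (x : ι → ℝ≥0∞) :
    (∑ i ∈ s, x i) ^ 2 ≤ 2 ^ s.card * ∑ i ∈ s, x i ^ 2 := by
  classical
  induction s using Finset.induction_on with
  | empty => simp
  | insert i s hi ih =>
    rw [Finset.sum_insert hi, Finset.sum_insert hi, Finset.card_insert_of_notMem hi]
    have h1 : (1 : ℝ≥0∞) ≤ 2 ^ s.card := one_le_pow₀ (by norm_num)
    calc (x i + ∑ j ∈ s, x j) ^ 2 ≤ 2 * x i ^ 2 + 2 * (∑ j ∈ s, x j) ^ 2 := ennreal_add_sq_le _ _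
      _ ≤ 2 * (2 ^ s.card * x i ^ 2) + 2 * (2 ^ s.card * ∑ j ∈ s, x j ^ 2) :=
          add_le_add (mul_le_mul_right (le_mul_of_one_le_left' h1) _) (mul_le_mul_right ih _)
      _ = 2 ^ (s.card + 1) * (x i ^ 2 + ∑ j ∈ s, x j ^ 2) := by ring

/-! ### Second moments of the nonlinear process -/

section Moments

variable {d n : ℕ} {Ω : Type*} [mΩ : MeasurableSpace Ω] {μ : Measure Ω} [IsProbabilityMeasure μ]
  {P : Kernel ℝ≥0 (E d)} [IsMarkovKernel P] {W : Fin n → Set (ℝ≥0 × E d) → Ω → E d}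
  {hW : ∀ i, IsWhiteNoise μ (covMeasure P) (W i)} {ξ : Fin n → Ω → E d}
  {hξ : ∀ i, Measurable (ξ i)} {σ : E d → Matrix (Fin d) (Fin d) ℝ} {b : E d → E d}
  {X : ℝ≥0 → Ω → E d}

lemma lintegral_Iic_pow_lt_top {x : ℝ≥0 → E d} (hx : Continuous x) (T : ℝ≥0) (p : ℕ) :
    ∫⁻ t in Set.Iic T, ‖x t‖ₑ ^ p ∂timeMeasure < ∞ := by
  have hcomp : IsCompact (Set.Iic T) := by
    rw [← Set.Icc_bot]; exact isCompact_Icc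
  obtain ⟨C, hC⟩ := hcomp.exists_bound_of_continuousOn hx.continuousOn
  calc ∫⁻ t in Set.Iic T, ‖x t‖ₑ ^ p ∂timeMeasure
      ≤ ∫⁻ _t in Set.Iic T, ENNReal.ofReal C ^ p ∂timeMeasure := by
        refine setLIntegral_mono' measurableSet_Iic fun t ht => pow_le_pow_left' ?_ p
        rw [← ofReal_norm]
        exact ENNReal.ofReal_le_ofReal (hC t ht)
    _ < ∞ := by
        rw [setLIntegral_const, timeMeasure_Iic]
        exact ENNReal.mul_lt_top (ENNReal.pow_lt_top ENNReal.ofReal_lt_top) ENNReal.coe_lt_top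

/-- The drift grows at most linearly along every path. The drift is integrable along some path
`ω₀`; along any other path it is compared with the drift along `ω₀`, by Lipschitz continuity. This
does not presuppose any moment of `P_s`. -/
lemma exists_enorm_drift_le {𝓕 : Filtration ℝ≥0 mΩ} {V : Set (ℝ≥0 × E d) → Ω → E d} {K : ℝ≥0}
    (hb : LipschitzWith K b) (hX : IsNonlinearProcess μ 𝓕 σ b P V X) (T : ℝ≥0) :
    ∃ C : ℝ≥0∞, C < ∞ ∧ ∀ t ≤ T, ∀ ω,
      ‖∫ s in Set.Iic t, ∫ y, b (X s ω - y) ∂(P s) ∂timeMeasure‖ₑ ≤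
        C + K * ∫⁻ s in Set.Iic t, ‖X s ω‖ₑ ∂timeMeasure := by
  obtain ⟨ω₀, hω₀⟩ := (hX.drift_integrable T).exists
  have hc : Continuous fun q : ℝ≥0 × E d => b (X q.1 ω₀ - q.2) :=
    hb.continuous.comp (((hX.continuous ω₀).comp continuous_fst).sub continuous_snd)
  have hcm : Measurable fun q : ℝ≥0 × E d => ‖b (X q.1 ω₀ - q.2)‖ₑ := hc.measurable.enorm
  have hXm : ∀ ω, Measurable fun s => ‖X s ω‖ₑ := fun ω => (hX.continuous ω).measurable.enorm
  set C₁ := ∫⁻ s in Set.Iic T, ∫⁻ y, ‖b (X s ω₀ - y)‖ₑ ∂(P s) ∂timeMeasure with hC₁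
  set C₂ := ∫⁻ s in Set.Iic T, ‖X s ω₀‖ₑ ∂timeMeasure with hC₂
  have hC₁fin : C₁ < ∞ := by
    have h := hω₀.2
    rw [hasFiniteIntegral_iff_enorm] at h
    unfold covMeasure at h
    rw [Measure.setLIntegral_compProd hcm measurableSet_Iic MeasurableSet.univ] at h
    simpa using h
  have hC₂fin : C₂ < ∞ := by
    simpa using lintegral_Iic_pow_lt_top (hX.continuous ω₀) T 1
  refine ⟨C₁ + K * C₂, ENNReal.add_lt_top.2 ⟨hC₁fin, ENNReal.mul_lt_top ENNReal.coe_lt_top hC₂fin⟩,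
    fun t ht ω => ?_⟩
  have hinner : Measurable fun s => ∫⁻ y, ‖b (X s ω₀ - y)‖ₑ ∂(P s) :=
    Measurable.lintegral_kernel_prod_right (f := fun s y => ‖b (X s ω₀ - y)‖ₑ) hcm
  have hpt : ∀ s, ‖∫ y, b (X s ω - y) ∂(P s)‖ₑ ≤
      ∫⁻ y, ‖b (X s ω₀ - y)‖ₑ ∂(P s) + (K * ‖X s ω₀‖ₑ + K * ‖X s ω‖ₑ) := by
    intro s
    refine (enorm_integral_le_lintegral_enorm _).trans ?_
    calc ∫⁻ y, ‖b (X s ω - y)‖ₑ ∂(P s)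
        ≤ ∫⁻ y, (‖b (X s ω₀ - y)‖ₑ + (K * ‖X s ω₀‖ₑ + K * ‖X s ω‖ₑ)) ∂(P s) := by
          refine lintegral_mono fun y => ?_
          have h1 := hb.edist_le_mul (X s ω - y) (X s ω₀ - y)
          rw [edist_sub_right, edist_eq_enorm_sub, edist_eq_enorm_sub] at h1
          calc ‖b (X s ω - y)‖ₑ
              = ‖b (X s ω₀ - y) + (b (X s ω - y) - b (X s ω₀ - y))‖ₑ := by
                rw [add_sub_cancel]
            _ ≤ ‖b (X s ω₀ - y)‖ₑ + ‖b (X s ω - y) - b (X s ω₀ - y)‖ₑ := enorm_add_le _ _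
            _ ≤ ‖b (X s ω₀ - y)‖ₑ + K * (‖X s ω‖ₑ + ‖X s ω₀‖ₑ) :=
                add_le_add le_rfl (h1.trans (mul_le_mul_right enorm_sub_le _))
            _ = _ := by ring
      _ = _ := by rw [lintegral_add_right _ measurable_const]; simp
  calc ‖∫ s in Set.Iic t, ∫ y, b (X s ω - y) ∂(P s) ∂timeMeasure‖ₑ
      ≤ ∫⁻ s in Set.Iic t, ‖∫ y, b (X s ω - y) ∂(P s)‖ₑ ∂timeMeasure :=
        enorm_integral_le_lintegral_enorm _
    _ ≤ ∫⁻ s in Set.Iic t, (∫⁻ y, ‖b (X s ω₀ - y)‖ₑ ∂(P s) +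
          (K * ‖X s ω₀‖ₑ + K * ‖X s ω‖ₑ)) ∂timeMeasure := lintegral_mono fun s => hpt s
    _ = ∫⁻ s in Set.Iic t, ∫⁻ y, ‖b (X s ω₀ - y)‖ₑ ∂(P s) ∂timeMeasure +
          (K * ∫⁻ s in Set.Iic t, ‖X s ω₀‖ₑ ∂timeMeasure +
            K * ∫⁻ s in Set.Iic t, ‖X s ω‖ₑ ∂timeMeasure) := by
        rw [lintegral_add_left hinner, lintegral_add_left ((hXm ω₀).const_mul _),
          lintegral_const_mul _ (hXm ω₀), lintegral_const_mul _ (hXm ω)]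
    _ ≤ C₁ + (K * C₂ + K * ∫⁻ s in Set.Iic t, ‖X s ω‖ₑ ∂timeMeasure) := by
        have hsub := Set.Iic_subset_Iic.2 ht
        exact add_le_add (lintegral_mono_set hsub)
          (add_le_add (mul_le_mul_right (lintegral_mono_set hsub) _) le_rfl)
    _ = _ := by ring

lemma measurable_process {𝓕 : Filtration ℝ≥0 mΩ} {V : Set (ℝ≥0 × E d) → Ω → E d}
    (hX : IsNonlinearProcess μ 𝓕 σ b P V X) : Measurable fun p : ℝ≥0 × Ω => X p.1 p.2 :=
  measurable_uncurry_of_continuous_of_measurable hX.continuous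
    fun t => (hX.adapted t).mono (𝓕.le t) le_rfl

lemma lintegral_process_sq {𝓕 : Filtration ℝ≥0 mΩ} {V : Set (ℝ≥0 × E d) → Ω → E d}
    (hX : IsNonlinearProcess μ 𝓕 σ b P V X) (t : ℝ≥0) :
    ∫⁻ ω, ‖X t ω‖ₑ ^ 2 ∂μ = ∫⁻ x, ‖x‖ₑ ^ 2 ∂(P t) := by
  rw [← hX.law t, lintegral_map (by fun_prop) ((hX.adapted t).mono (𝓕.le t) le_rfl)]

lemma enorm_le_sum_coord (v : E d) : ‖v‖ₑ ≤ ∑ j, ‖v j‖ₑ := by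
  conv_lhs => rw [← (EuclideanSpace.basisFun (Fin d) ℝ).sum_repr v]
  refine (enorm_sum_le _ _).trans (Finset.sum_le_sum fun j _ => ?_)
  have h1 : ‖EuclideanSpace.basisFun (Fin d) ℝ j‖ₑ = 1 := by
    rw [← ofReal_norm, (EuclideanSpace.basisFun (Fin d) ℝ).norm_eq_one, ENNReal.ofReal_one]
  rw [enorm_smul, h1, mul_one]
  simp

/-- Up to the drift, `|X_t|` is bounded by the sum `M` of the norms of the initial condition and of
the stochastic integrals, whose second moment is bounded uniformly in `t ≤ T`. -/
lemma exists_martingale_bound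
    (hind : iIndep (Sum.elim (fun i : Fin n => noiseSigma (covMeasure P) (W i))
      (fun i : Fin n => MeasurableSpace.comap (ξ i) inferInstance)) μ) {i : Fin n}
    (hσ : ∀ j k, Continuous fun x => σ x j k) (hP0 : ∫⁻ x, ‖x‖ₑ ^ 2 ∂(P 0) < ∞)
    (hX : IsNonlinearProcess μ (noiseFiltration μ P W hW ξ hξ) σ b P (W i) X) (T : ℝ≥0) :
    ∃ C : ℝ≥0∞, C < ∞ ∧ ∀ t ≤ T, ∃ M : Ω → ℝ≥0∞, ∫⁻ ω, M ω ^ 2 ∂μ ≤ C ∧ ∀ᵐ ω ∂μ,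
      ‖X t ω‖ₑ ≤ M ω + ‖∫ s in Set.Iic t, ∫ y, b (X s ω - y) ∂(P s) ∂timeMeasure‖ₑ := by
  let f : Fin d × Fin d → ℝ≥0 → Ω → E d → ℝ := fun jk s ω y => σ (X s ω - y) jk.1 jk.2
  have hXm := measurable_process hX
  have hf : ∀ jk, Measurable fun p : Ω × (ℝ≥0 × E d) => f jk p.2.1 p.1 p.2.2 := fun jk => by
    have h1 : Measurable fun p : Ω × (ℝ≥0 × E d) => X p.2.1 p.1 - p.2.2 :=
      (hXm.comp ((measurable_fst.comp measurable_snd).prodMk measurable_fst)).sub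
        (measurable_snd.comp measurable_snd)
    exact (hσ jk.1 jk.2).measurable.comp h1
  have hfT : ∀ jk, fieldNormSq μ (covMeasure P) T (f jk) < ∞ := fun jk => by
    obtain ⟨I, hI, -⟩ := hX.equation T
    exact (hI jk.1 jk.2).fieldNormSq_lt_top hind
  set N : ℝ≥0∞ := 2 ^ (Finset.univ : Finset (Fin d × Fin d)).card with hN
  have hNtop : N ≠ ∞ := ENNReal.pow_ne_top ENNReal.ofNat_ne_top
  refine ⟨2 * ∫⁻ x, ‖x‖ₑ ^ 2 ∂(P 0) +
    2 * (N * ∑ jk, (6 + 4 * fieldNormSq μ (covMeasure P) T (f jk))), ?_, fun t ht => ?_⟩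
  · refine ENNReal.add_lt_top.2 ⟨ENNReal.mul_lt_top ENNReal.ofNat_lt_top hP0,
      ENNReal.mul_lt_top ENNReal.ofNat_lt_top (ENNReal.mul_lt_top hNtop.lt_top
        (ENNReal.sum_lt_top.2 fun jk _ => ENNReal.add_lt_top.2 ⟨ENNReal.ofNat_lt_top,
          ENNReal.mul_lt_top ENNReal.ofNat_lt_top (hfT jk)⟩))⟩
  obtain ⟨I, hI, heq⟩ := hX.equation t
  have hIm : ∀ jk : Fin d × Fin d, AEMeasurable (fun ω => ‖I jk.1 jk.2 ω‖ₑ ^ 2) μ := fun jk =>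
    (hI jk.1 jk.2).1.enorm.pow_const 2
  refine ⟨fun ω => ‖X 0 ω‖ₑ + ∑ jk : Fin d × Fin d, ‖I jk.1 jk.2 ω‖ₑ, ?_, ?_⟩
  · have h0m : Measurable fun ω => ‖X 0 ω‖ₑ ^ 2 :=
      (((hX.adapted 0).mono ((noiseFiltration μ P W hW ξ hξ).le 0) le_rfl).enorm).pow_const 2
    have hsm : AEMeasurable (fun ω => ∑ jk : Fin d × Fin d, ‖I jk.1 jk.2 ω‖ₑ ^ 2) μ :=
      Finset.aemeasurable_fun_sum _ fun jk _ => hIm jk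
    calc ∫⁻ ω, (‖X 0 ω‖ₑ + ∑ jk : Fin d × Fin d, ‖I jk.1 jk.2 ω‖ₑ) ^ 2 ∂μ
        ≤ ∫⁻ ω, (2 * ‖X 0 ω‖ₑ ^ 2 +
            2 * (N * ∑ jk : Fin d × Fin d, ‖I jk.1 jk.2 ω‖ₑ ^ 2)) ∂μ := by
          refine lintegral_mono fun ω => (ennreal_add_sq_le _ _).trans ?_
          exact add_le_add le_rfl (mul_le_mul_right (sum_sq_le_two_pow_mul _ _) _)
      _ = 2 * ∫⁻ x, ‖x‖ₑ ^ 2 ∂(P 0) +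
            2 * (N * ∑ jk : Fin d × Fin d, ∫⁻ ω, ‖I jk.1 jk.2 ω‖ₑ ^ 2 ∂μ) := by
          rw [lintegral_add_left (h0m.const_mul 2), lintegral_const_mul _ h0m,
            lintegral_process_sq hX 0, lintegral_const_mul' _ _ ENNReal.ofNat_ne_top,
            lintegral_const_mul' _ _ hNtop, lintegral_finsetSum' _ fun jk _ => hIm jk]
      _ ≤ _ := by
          refine add_le_add le_rfl (mul_le_mul_right (mul_le_mul_right
            (Finset.sum_le_sum fun jk _ => ?_) _) _)
          refine ((hI jk.1 jk.2).lintegral_sq_le hind (hf jk)).trans ?_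
          exact add_le_add le_rfl (mul_le_mul_right (fieldNormSq_mono _ _ ht _) _)
  · filter_upwards [heq] with ω hω
    set D := ∫ s in Set.Iic t, ∫ y, b (X s ω - y) ∂(P s) ∂timeMeasure with hD
    have hv : ‖X t ω - X 0 ω - D‖ₑ ≤ ∑ jk : Fin d × Fin d, ‖I jk.1 jk.2 ω‖ₑ := by
      refine (enorm_le_sum_coord _).trans ?_
      rw [Fintype.sum_prod_type]
      refine Finset.sum_le_sum fun j _ => ?_
      have : (X t ω - X 0 ω - D) j = ∑ k, I j k ω := by
        simp only [PiLp.sub_apply, hω j]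
        ring
      rw [this]
      exact enorm_sum_le _ _
    calc ‖X t ω‖ₑ = ‖X 0 ω + (X t ω - X 0 ω - D) + D‖ₑ := by congr 1; abel
      _ ≤ ‖X 0 ω‖ₑ + ‖X t ω - X 0 ω - D‖ₑ + ‖D‖ₑ :=
          (enorm_add_le _ _).trans (add_le_add (enorm_add_le _ _) le_rfl)
      _ ≤ _ := add_le_add (add_le_add le_rfl hv) le_rfl

/-- Gronwall's lemma for a path whose norm is bounded by `N + C` up to a drift of linear growth. -/
lemma lintegral_exp_mul_sq_le {x : ℝ≥0 → E d} (hx : Continuous x) {N : ℝ≥0 → ℝ≥0∞}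
    (hN : Measurable N) {C : ℝ≥0∞} {K T κ : ℝ≥0} (hκ : κ = 4 * K ^ 2 * T)
    (h : ∀ t ≤ T, ‖x t‖ₑ ≤ N t + (C + K * ∫⁻ s in Set.Iic t, ‖x s‖ₑ ∂timeMeasure)) :
    ∫⁻ t in Set.Iic T, ENNReal.ofReal (Real.exp (-(2 * κ + 1) * t)) * ‖x t‖ₑ ^ 2 ∂timeMeasure ≤
      2 * ∫⁻ t in Set.Iic T, (2 * N t ^ 2 + 4 * C ^ 2) ∂timeMeasure := by
  have hxm : Measurable fun t => ‖x t‖ₑ := hx.measurable.enorm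
  refine lintegral_exp_mul_le_of_le_add_lintegral (hxm.pow_const 2)
    (((hN.pow_const 2).const_mul 2).add_const _)
    (lintegral_Iic_pow_lt_top hx T 2) fun t ht => ?_
  have h0 := h t ht
  set y := ∫⁻ s in Set.Iic t, ‖x s‖ₑ ∂timeMeasure
  set z := ∫⁻ s in Set.Iic t, ‖x s‖ₑ ^ 2 ∂timeMeasure
  have hyz : y ^ 2 ≤ T * z := by
    refine (sq_lintegral_Iic_le hxm t).trans ?_
    gcongr
  clear_value y z
  have h1 := ennreal_add_sq_le (N t) (C + K * y)
  have h2 := ennreal_add_sq_le C (K * y)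
  calc ‖x t‖ₑ ^ 2 ≤ (N t + (C + K * y)) ^ 2 := pow_le_pow_left' h0 2
    _ ≤ 2 * N t ^ 2 + 2 * (2 * C ^ 2 + 2 * (K * y) ^ 2) := h1.trans (by gcongr)
    _ = 2 * N t ^ 2 + 4 * C ^ 2 + 4 * K ^ 2 * y ^ 2 := by ring
    _ ≤ 2 * N t ^ 2 + 4 * C ^ 2 + 4 * K ^ 2 * (T * z) := by gcongr
    _ = 2 * N t ^ 2 + 4 * C ^ 2 + κ * z := by rw [hκ]; push_cast; ring

/-- The laws `P_t` have a finite second moment, for almost every `t`. Gronwall's lemma is applied to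
each path, where the integrals are finite by continuity, and the result is integrated over `ω`; an
argument on second moments alone would presuppose that they are finite. -/
theorem ae_lintegral_sq_lt_top
    (hind : iIndep (Sum.elim (fun i : Fin n => noiseSigma (covMeasure P) (W i))
      (fun i : Fin n => MeasurableSpace.comap (ξ i) inferInstance)) μ) {i : Fin n}
    (hσ : ∀ j k, Continuous fun x => σ x j k) {K : ℝ≥0} (hb : LipschitzWith K b)
    (hP0 : ∫⁻ x, ‖x‖ₑ ^ 2 ∂(P 0) < ∞)
    (hX : IsNonlinearProcess μ (noiseFiltration μ P W hW ξ hξ) σ b P (W i) X) :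
    ∀ᵐ t ∂timeMeasure, ∫⁻ x, ‖x‖ₑ ^ 2 ∂(P t) < ∞ := by
  suffices h : ∀ T : ℕ, ∀ᵐ t : ℝ≥0 ∂timeMeasure, t ≤ (T : ℝ≥0) → ∫⁻ x, ‖x‖ₑ ^ 2 ∂(P t) < ∞ by
    filter_upwards [ae_all_iff.2 h] with t ht
    obtain ⟨T, hT⟩ := exists_nat_ge t
    exact ht T hT
  intro T'
  set T : ℝ≥0 := (T' : ℝ≥0) with hT
  have hXm := measurable_process hX
  obtain ⟨C, hC, hdrift⟩ := exists_enorm_drift_le hb hX T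
  obtain ⟨C', hC', hmart⟩ := exists_martingale_bound hind hσ hP0 hX T
  let Y : ℝ≥0 → Ω → ℝ≥0∞ := fun t ω => ∫⁻ s in Set.Iic t, ‖X s ω‖ₑ ∂timeMeasure
  have hYm : Measurable fun p : ℝ≥0 × Ω => Y p.1 p.2 := by
    have heq : ∀ p : ℝ≥0 × Ω, Y p.1 p.2 =
        ∫⁻ s, {q : (ℝ≥0 × Ω) × ℝ≥0 | q.2 ≤ q.1.1}.indicator
          (fun q => ‖X q.2 q.1.2‖ₑ) (p, s) ∂timeMeasure := fun p => by
      simp only [Y]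
      rw [← lintegral_indicator measurableSet_Iic]
      rfl
    simp only [heq]
    refine Measurable.lintegral_prod_right' (f := {q : (ℝ≥0 × Ω) × ℝ≥0 | q.2 ≤ q.1.1}.indicator
      fun q => ‖X q.2 q.1.2‖ₑ) ?_
    refine Measurable.indicator ?_ (measurableSet_le measurable_snd (by fun_prop))
    exact (hXm.comp (measurable_snd.prodMk (measurable_snd.comp measurable_fst))).enorm
  -- the part of `X t` that is not explained by the drift
  let N : ℝ≥0 → Ω → ℝ≥0∞ := fun t ω => ‖X t ω‖ₑ - (C + K * Y t ω)
  have hNm : Measurable fun p : ℝ≥0 × Ω => N p.1 p.2 :=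
    hXm.enorm.sub ((hYm.const_mul _).const_add _)
  have hN : ∀ t ≤ T, ∫⁻ ω, N t ω ^ 2 ∂μ ≤ C' := by
    intro t ht
    obtain ⟨M, hM, hle⟩ := hmart t ht
    refine (lintegral_mono_ae ?_).trans hM
    filter_upwards [hle] with ω hω
    refine pow_le_pow_left' (tsub_le_iff_right.2 (hω.trans ?_)) 2
    exact add_le_add le_rfl (hdrift t ht ω)
  let A : ℝ≥0 → Ω → ℝ≥0∞ := fun t ω => 2 * N t ω ^ 2 + 4 * C ^ 2
  have hAm : Measurable fun p : ℝ≥0 × Ω => A p.1 p.2 :=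
    ((hNm.pow_const 2).const_mul 2).add_const _
  set κ : ℝ≥0 := 4 * K ^ 2 * T with hκ
  let e : ℝ≥0 → ℝ≥0∞ := fun t => ENNReal.ofReal (Real.exp (-(2 * κ + 1) * t))
  have hem : Measurable e := by simp only [e]; fun_prop
  have hpath : ∀ ω, ∫⁻ t in Set.Iic T, e t * ‖X t ω‖ₑ ^ 2 ∂timeMeasure ≤
      2 * ∫⁻ t in Set.Iic T, A t ω ∂timeMeasure := fun ω =>
    lintegral_exp_mul_sq_le (hX.continuous ω) (hNm.comp measurable_prodMk_right) hκ
      fun t _ => le_tsub_add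
  have hAint : ∫⁻ ω, ∫⁻ t in Set.Iic T, A t ω ∂timeMeasure ∂μ < ∞ := by
    rw [lintegral_lintegral_swap (f := fun ω t => A t ω)
      (hAm.comp measurable_swap).aemeasurable]
    calc ∫⁻ t in Set.Iic T, ∫⁻ ω, A t ω ∂μ ∂timeMeasure
        ≤ ∫⁻ _t in Set.Iic T, (2 * C' + 4 * C ^ 2) ∂timeMeasure := by
          refine setLIntegral_mono' measurableSet_Iic fun t ht => ?_
          simp only [A]
          rw [lintegral_add_right _ measurable_const,
            lintegral_const_mul' _ _ ENNReal.ofNat_ne_top]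
          refine add_le_add (mul_le_mul_right (hN t ht) _) ?_
          simp
      _ < ∞ := by
          rw [setLIntegral_const, timeMeasure_Iic]
          exact ENNReal.mul_lt_top (ENNReal.add_lt_top.2
            ⟨ENNReal.mul_lt_top ENNReal.ofNat_lt_top hC',
              ENNReal.mul_lt_top ENNReal.ofNat_lt_top (ENNReal.pow_lt_top hC)⟩)
            ENNReal.coe_lt_top
  have hfm : Measurable fun p : Ω × ℝ≥0 => e p.2 * ‖X p.2 p.1‖ₑ ^ 2 :=
    (hem.comp measurable_snd).mul ((hXm.comp measurable_swap).enorm.pow_const 2)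
  have hfin : ∫⁻ t in Set.Iic T, ∫⁻ ω, e t * ‖X t ω‖ₑ ^ 2 ∂μ ∂timeMeasure < ∞ := by
    rw [← lintegral_lintegral_swap (f := fun ω t => e t * ‖X t ω‖ₑ ^ 2) hfm.aemeasurable]
    refine (lintegral_mono hpath).trans_lt ?_
    rw [lintegral_const_mul' _ _ ENNReal.ofNat_ne_top]
    exact ENNReal.mul_lt_top ENNReal.ofNat_lt_top hAint
  have hae := ae_lt_top (μ := timeMeasure.restrict (Set.Iic T))
    (hfm.comp measurable_swap).lintegral_prod_right' hfin.ne
  rw [ae_restrict_iff' measurableSet_Iic] at hae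
  filter_upwards [hae] with t ht htT
  have h1 : e t * ∫⁻ ω, ‖X t ω‖ₑ ^ 2 ∂μ < ∞ := by
    rw [← lintegral_const_mul' _ _ ENNReal.ofReal_ne_top]
    exact ht htT
  rw [lintegral_process_sq hX t] at h1
  refine lt_top_iff_ne_top.2 fun htop => ?_
  rw [htop, ENNReal.mul_top (ENNReal.ofReal_pos.2 (Real.exp_pos _)).ne'] at h1
  exact lt_irrefl _ h1

end Moments

end NonlinearDiffusion

end

theorem theorem2 {d n : ℕ} (hn : 0 < n)
    {Ω : Type*} [mΩ : MeasurableSpace Ω] (μ : Measure Ω) [IsProbabilityMeasure μ]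
    -- the coefficients are Lipschitz continuous
    (σ : NonlinearDiffusion.E d → Matrix (Fin d) (Fin d) ℝ)
    (b : NonlinearDiffusion.E d → NonlinearDiffusion.E d)
    (hσ : ∃ K : ℝ≥0, ∀ j k, LipschitzWith K fun x => σ x j k)
    (hb : ∃ K : ℝ≥0, LipschitzWith K b)
    -- the laws `P_t`
    (P : Kernel ℝ≥0 (NonlinearDiffusion.E d)) [IsMarkovKernel P]
    (hP0 : ∫⁻ x, ‖x‖ₑ ^ 2 ∂(P 0) < ∞)
    (hP : ∀ t, 0 < t → P t ≪ volume)
    -- the white noises `W^i` and the processes `X^i`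
    (W : Fin n → Set (ℝ≥0 × NonlinearDiffusion.E d) → Ω → NonlinearDiffusion.E d)
    (hW : ∀ i, NonlinearDiffusion.IsWhiteNoise μ (NonlinearDiffusion.covMeasure P) (W i))
    (X : Fin n → ℝ≥0 → Ω → NonlinearDiffusion.E d)
    (hX0 : ∀ i, Measurable (X i 0))
    -- the white noises and the initial conditions are independent
    (hind : iIndep (Sum.elim
      (fun i : Fin n => NonlinearDiffusion.noiseSigma (NonlinearDiffusion.covMeasure P) (W i))
      (fun i : Fin n => MeasurableSpace.comap (X i 0) inferInstance)) μ)
    -- the `X^i` are independent copies of the nonlinear process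
    (hX : ∀ i, NonlinearDiffusion.IsNonlinearProcess μ
      (NonlinearDiffusion.noiseFiltration μ P W hW (fun i => X i 0) hX0) σ b P (W i) (X i))
    (hXind : iIndepFun (fun (i : Fin n) (ω : Ω) (t : ℝ≥0) => X i t ω) μ) :
    ∃ T : ℝ≥0 → Ω → NonlinearDiffusion.E d → NonlinearDiffusion.E d,
      Measurable[(NonlinearDiffusion.noiseFiltration μ P W hW
          (fun i => X i 0) hX0).predictable.prod inferInstance]
        (fun q : (ℝ≥0 × Ω) × NonlinearDiffusion.E d => T q.1.1 q.1.2 q.2) ∧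
      ∀ᵐ p ∂(NonlinearDiffusion.timeMeasure.prod μ),
        (∃ S, NonlinearDiffusion.IsBrenierMap (P p.1)
          (NonlinearDiffusion.empirical fun i => X i p.1 p.2) S) ∧
        ∀ S, NonlinearDiffusion.IsBrenierMap (P p.1)
          (NonlinearDiffusion.empirical fun i => X i p.1 p.2) S →
            T p.1 p.2 =ᵐ[P p.1] S := by
  have : NeZero n := ⟨hn.ne'⟩
  obtain ⟨Kσ, hσ⟩ := hσ
  obtain ⟨Kb, hb⟩ := hb
  obtain ⟨G, hG, hBrenier⟩ := NonlinearDiffusion.exists_measurable_brenierMap (n := n) P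
  refine ⟨fun t ω x => G ((t, fun i => X i t ω), x), ?_, ?_⟩
  · set 𝓕 := NonlinearDiffusion.noiseFiltration μ P W hW (fun i => X i 0) hX0
    have ht : Measurable[𝓕.predictable] (Prod.fst : ℝ≥0 × Ω → ℝ≥0) :=
      NonlinearDiffusion.measurable_predictable_of_continuous (X := fun t _ => t)
        (fun _ => continuous_id) fun t => @measurable_const _ _ _ (𝓕 t) t
    have hXp : ∀ i, Measurable[𝓕.predictable] fun p : ℝ≥0 × Ω => X i p.1 p.2 := fun i =>
      NonlinearDiffusion.measurable_predictable_of_continuous (hX i).continuous (hX i).adapted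
    let _ : MeasurableSpace (ℝ≥0 × Ω) := 𝓕.predictable
    have hpair : Measurable fun p : ℝ≥0 × Ω => (p.1, fun i => X i p.1 p.2) :=
      ht.prodMk (measurable_pi_lambda _ hXp)
    exact hG.comp ((hpair.comp measurable_fst).prodMk measurable_snd)
  · have hsq := NonlinearDiffusion.ae_lintegral_sq_lt_top (i := ⟨0, hn⟩) hind
      (fun j k => (hσ j k).continuous) hb hP0 (hX ⟨0, hn⟩)
    -- at time `0` the law need not have a density
    have hpos : ∀ᵐ t ∂NonlinearDiffusion.timeMeasure, 0 < t := by
      rw [ae_iff]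
      have : {t : ℝ≥0 | ¬ 0 < t} = Set.Iic 0 := by ext; simp
      rw [this, NonlinearDiffusion.timeMeasure_Iic, ENNReal.coe_zero]
    filter_upwards [Measure.quasiMeasurePreserving_fst.ae (hpos.and hsq)] with p hp
    have hS := hBrenier p.1 (fun i => X i p.1 p.2) (hP p.1 hp.1) hp.2
    exact ⟨⟨_, hS⟩, fun S hS' => hS.ae_eq hS'⟩
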